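/- **Setting.** Fix a finite relational schema $\sigma$ (all arities at least $1$) and an integer $d\ge 2$. A $\sigma$-database (db) $\mathcal D$ has a finite domain $D$ and, for each $R\in\sigma$, a relation $R^{\mathcal D}\subseteq D^{\mathrm{ar}(R)}$; its degree is the maximum, over $a\in D$, of the number of tuples (in all relations) containing $a$. Distances and connected components are those of the Gaifman graph, in which two distinct elements are adjacent if they occur in a common tuple. The $r$-type of $a\in D$ is the isomorphism class of $(\mathcal D[N_r(a)],a)$, where $N_r(a)$ is the set of elements at distance at most $r$ from $a$ and $\mathcal D[\cdot]$ is the induced sub-db. Let $T_r$ be the set of $r$-types with degree at most $d$. The $r$-histogram $\mathrm h_r(\mathcal D)\in\mathbb N^{T_r}$ counts the elements of each $r$-type, $\mathrm{dv}_r(\mathcal D)=\mathrm h_r(\mathcal D)/|D|$, and $\mathrm h_r(\mathbf P)=\{\mathrm h_r(\mathcal D):\mathcal D\in\mathbf P\}$. A set of vectors is semilinear if it is a finite union of sets of the form $\{v_0+a_1v_1+\dots+a_kv_k: a_i\in\mathbb N\}$. The distance $\mathrm{dist}_{+/ -}(\mathcal D,\mathcal D')$ is the minimum number of modifications of $\mathcal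 D$ and $\mathcal D'$ that make them isomorphic, a modification being the insertion of an element, the deletion of an element (together with all tuples containing it), the insertion of a tuple, or the deletion of a tuple. $\mathcal D,\mathcal D'$ are $\epsilon$-close if $\mathrm{dist}_{+/ -}(\mathcal D,\mathcal D')\le \epsilon d\min\{|D|,|D'|\}$. $\mathcal D$ is $\epsilon$-close to $\mathbf P$ if it is $\epsilon$-close to some member of $\mathbf P$, and $\epsilon$-far from $\mathbf P$ otherwise (this is the $\mathrm{BDRD}_{+/ -}$ model). Let $\mathbf C$ be an isomorphism-closed class of $\sigma$-dbs of degree at most $d$ that is closed under removing tuples, and let $\mathbf P\subseteq\mathbf C$ be isomorphism-closed and hyperfinite on $\mathbf C$: there is a function $\rho:(0,1]\to\mathbb N$ such that for all $\delta\in(0,1]$ and $\mathcal D\in\mathbf P$ some db in $\mathbf C$ is obtained from $\mathcal D$ by removing at most $\delta|D|$ tuples and has all connected components of size at most $\rho(\delta)$. For $\epsilon\in(0,1]$ call $r\in\mathbb N$ a *locality radius* for $\epsilon$ if there is $\lambda\in(0,1]$ such that for all $\mathcal D\in\mathbf P$ and $\mathcal D'\in\mathbf C$, $\|\mathrm h_r(\mathcal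 D)-\mathrm h_r(\mathcal D')\|_1\le\lambda\min\{|D|,|D'|\}$ implies that $\mathcal D'$ is $\epsilon$-close to $\mathbf P$. **Theorem.** Let $\epsilon\in(0,1]$. A locality radius for $\epsilon$ exists. Moreover, for every locality radius $r$ for $\epsilon$ such that $\mathrm h_r(\mathbf P)$ is semilinear, there are $n_{\min},n_{\max}\in\mathbb N$ and $f,\mu\in(0,1)$ such that for every $\mathcal D\in\mathbf C$ with $|D|>n_{\max}$: 1. if $\mathcal D\in\mathbf P$, then there is $\mathcal D'\in\mathbf P$ with $n_{\min}\le|D'|\le n_{\max}$ and $\|\mathrm{dv}_r(\mathcal D)-\mathrm{dv}_r(\mathcal D')\|_1\le f-\mu$; 2. if $\mathcal D$ is $\epsilon$-far from $\mathbf P$, then every $\mathcal D'\in\mathbf P$ with $n_{\min}\le|D'|\le n_{\max}$ satisfies $\|\mathrm{dv}_r(\mathcal D)-\mathrm{dv}_r(\mathcal D')\|_1>f+\mu$. -/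

import Mathlib

/-- A relational schema: finitely many relation names, each with an arity at least one. -/
structure RelSchema where
  numRel : ℕ
  arity : Fin numRel → ℕ
  arity_pos : ∀ R, 1 ≤ arity R

/-- A tuple of natural numbers of the correct length, tagged by a relation name: `⟨R, t⟩` stands
for "the tuple `t` in the relation `R`". -/
abbrev RelTuple (σ : RelSchema) : Type :=
  Σ R : Fin σ.numRel, (Fin (σ.arity R) → ℕ)

/-- The set of elements occurring in a tuple. -/
def RelTuple.elems {σ : RelSchema} (t : RelTuple σ) : Finset ℕ :=
  Finset.univ.image t.2

/-- A (finite) database of schema `σ`. Its domain is a finite set of natural numbers (so that it is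
linearly ordered), and the relation `R` of the database is `{t | ⟨R, t⟩ ∈ tuples}`. -/
structure RelDB (σ : RelSchema) where
  dom : Finset ℕ
  tuples : Finset (RelTuple σ)
  elems_subset : ∀ t ∈ tuples, t.elems ⊆ dom

namespace RelDB

variable {σ : RelSchema}

/-- The number of elements `|D|`. -/
def size (D : RelDB σ) : ℕ := D.dom.card

/-- The number of tuples, in all relations of the database, that contain `a`. -/
def degree (D : RelDB σ) (a : ℕ) : ℕ := (D.tuples.filter (fun t => a ∈ t.elems)).card

/-- The degree of the database is at most `d`. -/
def DegreeLE (d : ℕ) (D : RelDB σ) : Prop := ∀ a ∈ D.dom, D.degree a ≤ d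

/-- Isomorphisms of databases. -/
structure Iso (D E : RelDB σ) where
  toEquiv : D.dom ≃ E.dom
  mem_iff : ∀ (R : Fin σ.numRel) (t : Fin (σ.arity R) → D.dom),
    (⟨R, fun i => (t i : ℕ)⟩ : RelTuple σ) ∈ D.tuples ↔
      (⟨R, fun i => (toEquiv (t i) : ℕ)⟩ : RelTuple σ) ∈ E.tuples

def Iso.refl (D : RelDB σ) : Iso D D := ⟨Equiv.refl _, fun _ _ => Iff.rfl⟩

def Iso.symm {D E : RelDB σ} (e : Iso D E) : Iso E D :=
  ⟨e.toEquiv.symm, fun R t => by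
    have h := e.mem_iff R (fun i => e.toEquiv.symm (t i))
    simp only [Equiv.apply_symm_apply] at h
    exact h.symm⟩

def Iso.trans {D E F : RelDB σ} (e : Iso D E) (e' : Iso E F) : Iso D F :=
  ⟨e.toEquiv.trans e'.toEquiv, fun R t =>
    (e.mem_iff R t).trans (e'.mem_iff R (fun i => e.toEquiv (t i)))⟩

/-- The Gaifman graph. It is a graph on `ℕ`, in which the numbers outside the domain are
isolated. -/
def gaifman (D : RelDB σ) : SimpleGraph ℕ where
  Adj a b := a ≠ b ∧ ∃ t ∈ D.tuples, a ∈ t.elems ∧ b ∈ t.elems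
  symm := ⟨fun _ _ h => ⟨h.1.symm, h.2.imp fun _ ht => ⟨ht.1, ht.2.2, ht.2.1⟩⟩⟩
  loopless := ⟨fun _ h => h.1 rfl⟩

/-- The sub-database induced by (the elements of the domain that lie in) `M`. -/
def induced (D : RelDB σ) (M : Finset ℕ) : RelDB σ where
  dom := D.dom ∩ M
  tuples := D.tuples.filter (fun t => t.elems ⊆ M)
  elems_subset := fun t ht => by
    rw [Finset.mem_filter] at ht
    exact Finset.subset_inter (D.elems_subset t ht.1) ht.2

open Classical in
/-- `N_r(a)`: the elements at distance at most `r` from `a` in the Gaifman graph (`edist` is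
infinite between different components). -/
noncomputable def ball (D : RelDB σ) (r : ℕ) (a : ℕ) : Finset ℕ :=
  D.dom.filter (fun b => D.gaifman.edist a b ≤ (r : ℕ∞))

open Classical in
/-- The elements of the connected component of `a`. -/
noncomputable def component (D : RelDB σ) (a : ℕ) : Finset ℕ :=
  D.dom.filter (fun b => D.gaifman.Reachable a b)

/-- `E` is obtained from `D` by removing tuples. -/
def IsTupleRemoval (D E : RelDB σ) : Prop := E.dom = D.dom ∧ E.tuples ⊆ D.tuples

/-- `E` is an `(ε, k)`-partition of `D`. -/
def IsPartition (ε : ℝ) (k : ℕ) (D E : RelDB σ) : Prop :=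
  IsTupleRemoval D E ∧ ((D.tuples \ E.tuples).card : ℝ) ≤ ε * D.size ∧
    ∀ a ∈ E.dom, (E.component a).card ≤ k

/-- A class of databases is closed under isomorphism. -/
def IsoClosed (C : Set (RelDB σ)) : Prop :=
  ∀ D ∈ C, ∀ E : RelDB σ, Nonempty (Iso D E) → E ∈ C

/-- A class of databases is closed under removing tuples. -/
def RemovalClosed (C : Set (RelDB σ)) : Prop :=
  ∀ D ∈ C, ∀ E : RelDB σ, IsTupleRemoval D E → E ∈ C

/-- `P` is hyperfinite on `C` (used for `P ⊆ C`). -/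
def HyperfiniteOn (P C : Set (RelDB σ)) : Prop :=
  ∃ ρ : ℝ → ℕ, ∀ ε : ℝ, 0 < ε → ε ≤ 1 → ∀ D ∈ P, ∃ E ∈ C, IsPartition ε (ρ ε) D E

/-- A database with a distinguished element, its centre. -/
structure Pointed (σ : RelSchema) where
  db : RelDB σ
  centre : ℕ
  centre_mem : centre ∈ db.dom

/-- Isomorphism of databases with a centre, the centre being mapped to the centre. -/
instance pointedSetoid (σ : RelSchema) : Setoid (Pointed σ) where
  r A B := ∃ e : Iso A.db B.db, (e.toEquiv ⟨A.centre, A.centre_mem⟩ : ℕ) = B.centre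
  iseqv :=
    { refl := fun A => ⟨Iso.refl A.db, rfl⟩
      symm := by
        rintro A B ⟨e, he⟩
        refine ⟨e.symm, ?_⟩
        have h : e.toEquiv ⟨A.centre, A.centre_mem⟩ = ⟨B.centre, B.centre_mem⟩ := Subtype.ext he
        change ((e.toEquiv.symm ⟨B.centre, B.centre_mem⟩ : A.db.dom) : ℕ) = A.centre
        rw [← h, Equiv.symm_apply_apply]
      trans := by
        rintro A B E ⟨e, he⟩ ⟨e', he'⟩
        refine ⟨e.trans e', ?_⟩
        have h : e.toEquiv ⟨A.centre, A.centre_mem⟩ = ⟨B.centre, B.centre_mem⟩ := Subtype.ext he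
        change ((e'.toEquiv (e.toEquiv ⟨A.centre, A.centre_mem⟩) : E.db.dom) : ℕ) = E.centre
        rw [h, he'] }

/-- The `r`-neighbourhood `(D[N_r(a)], a)` of an element `a`. -/
noncomputable def neighbourhood (D : RelDB σ) (r : ℕ) (a : D.dom) : Pointed σ where
  db := D.induced (D.ball r a)
  centre := a
  centre_mem := Finset.mem_inter.2 ⟨a.2, Finset.mem_filter.2 ⟨a.2, by simp⟩⟩

/-- The isomorphism class of the `r`-neighbourhood of `a`. -/
noncomputable def typeOf (D : RelDB σ) (r : ℕ) (a : D.dom) : Quotient (pointedSetoid σ) :=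
  Quotient.mk _ (D.neighbourhood r a)

/-- The `r`-types with degree at most `d`: the isomorphism classes of the `r`-neighbourhoods of
databases of degree at most `d`. -/
def RType (σ : RelSchema) (d r : ℕ) : Type :=
  {τ : Quotient (pointedSetoid σ) //
    ∃ (D : RelDB σ) (a : D.dom), D.DegreeLE d ∧ D.typeOf r a = τ}

open Classical in
/-- The `r`-histogram: how many elements have `r`-type `τ`, for each `r`-type `τ`. -/
noncomputable def hist (d r : ℕ) (D : RelDB σ) : RType σ d r → ℕ :=
  fun τ => (Finset.univ.filter (fun a : D.dom => D.typeOf r a = τ.1)).card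

/-- The `r`-neighbourhood distribution vector. -/
noncomputable def dv (d r : ℕ) (D : RelDB σ) : RType σ d r → ℝ :=
  fun τ => (D.hist d r τ : ℝ) / D.size

/-- The `ℓ¹`-distance between the `r`-histograms. Only types that are realised in one of the two
(finite) databases contribute, so the sum is finite. -/
noncomputable def histDist (d r : ℕ) (D E : RelDB σ) : ℝ :=
  ∑ᶠ τ : RType σ d r, |(D.hist d r τ : ℝ) - (E.hist d r τ : ℝ)|

/-- The `ℓ¹`-distance between the `r`-neighbourhood distribution vectors. -/
noncomputable def dvDist (d r : ℕ) (D E : RelDB σ) : ℝ :=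
  ∑ᶠ τ : RType σ d r, |D.dv d r τ - E.dv d r τ|

/-- `E` arises from `D` by one modification: inserting a new element, deleting an element together
with all tuples that contain it, inserting a tuple, or deleting a tuple. -/
inductive Modification (D E : RelDB σ) : Prop
  | insertElem (a : ℕ) (ha : a ∉ D.dom) (hdom : E.dom = insert a D.dom)
      (htup : E.tuples = D.tuples)
  | deleteElem (a : ℕ) (ha : a ∈ D.dom) (hdom : E.dom = D.dom.erase a)
      (htup : E.tuples = D.tuples.filter (fun t => a ∉ t.elems))
  | insertTuple (t : RelTuple σ) (ht : t ∉ D.tuples) (hdom : E.dom = D.dom)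
      (htup : E.tuples = insert t D.tuples)
  | deleteTuple (t : RelTuple σ) (ht : t ∈ D.tuples) (hdom : E.dom = D.dom)
      (htup : E.tuples = D.tuples.erase t)

/-- `ModSteps n D E`: `E` arises from `D` by a sequence of `n` modifications. -/
inductive ModSteps : ℕ → RelDB σ → RelDB σ → Prop
  | refl (D : RelDB σ) : ModSteps 0 D D
  | step {n : ℕ} {D E F : RelDB σ} (h : Modification D E) (hs : ModSteps n E F) :
      ModSteps (n + 1) D F

/-- The possible total numbers of modifications, to `D` and to `E`, that make them isomorphic. -/
def modCounts (D E : RelDB σ) : Set ℕ :=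
  {m | ∃ (i j : ℕ) (D' E' : RelDB σ),
    ModSteps i D D' ∧ ModSteps j E E' ∧ Nonempty (Iso D' E') ∧ m = i + j}

/-- The distance of two databases: the minimum number of modifications to `D` and `E` that make
them isomorphic. -/
noncomputable def distPM (D E : RelDB σ) : ℕ := sInf (modCounts D E)

/-- Every database can be reduced to the empty one by modifications. -/
theorem exists_modSteps_empty (D : RelDB σ) :
    ∃ E : RelDB σ, E.dom = ∅ ∧ ModSteps D.dom.card D E := by
  generalize hn : D.dom.card = n
  induction n generalizing D with
  | zero => exact ⟨D, Finset.card_eq_zero.1 hn, ModSteps.refl D⟩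
  | succ n ih =>
    obtain ⟨a, ha⟩ : D.dom.Nonempty := Finset.card_pos.1 (by omega)
    let D' : RelDB σ :=
      { dom := D.dom.erase a
        tuples := D.tuples.filter (fun t => a ∉ t.elems)
        elems_subset := fun t ht => by
          rw [Finset.mem_filter] at ht
          exact Finset.subset_erase.2 ⟨D.elems_subset t ht.1, ht.2⟩ }
    have hD' : D'.dom.card = n := by
      change (D.dom.erase a).card = n
      rw [Finset.card_erase_of_mem ha, hn]; rfl
    obtain ⟨E, hE, hs⟩ := ih D' hD'
    exact ⟨E, hE, ModSteps.step (Modification.deleteElem a ha rfl rfl) hs⟩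

/-- The minimum in the definition of the distance is over a nonempty set. -/
theorem modCounts_nonempty (D E : RelDB σ) : (modCounts D E).Nonempty := by
  obtain ⟨D', hD', hs⟩ := exists_modSteps_empty D
  obtain ⟨E', hE', hs'⟩ := exists_modSteps_empty E
  have : IsEmpty D'.dom := by rw [hD']; infer_instance
  have : IsEmpty E'.dom := by rw [hE']; infer_instance
  exact ⟨_, _, _, D', E', hs, hs', ⟨⟨Equiv.equivOfIsEmpty _ _, fun R t =>
    isEmptyElim (t ⟨0, σ.arity_pos R⟩)⟩⟩, rfl⟩

/-- `D` and `E` are `ε`-close (for the degree bound `d`), with element and tuple modifications. -/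
def Close (d : ℕ) (ε : ℝ) (D E : RelDB σ) : Prop :=
  (distPM D E : ℝ) ≤ ε * d * min (D.size : ℝ) (E.size : ℝ)

/-- `D` is `ε`-close to the property `P`. -/
def CloseTo (d : ℕ) (ε : ℝ) (P : Set (RelDB σ)) (D : RelDB σ) : Prop :=
  ∃ E ∈ P, Close d ε D E

/-- `D` is `ε`-far from the property `P`. -/
def FarFrom (d : ℕ) (ε : ℝ) (P : Set (RelDB σ)) (D : RelDB σ) : Prop :=
  ¬ CloseTo d ε P D

/-- `r` is a locality radius for `P` on `C` and `ε`: for some `lam ∈ (0, 1]`, every database in `C`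
whose `r`-histogram is, up to `lam` times the smaller size, that of a database in `P` is
`ε`-close to `P`. -/
def IsLocalityRadius (d : ℕ) (C P : Set (RelDB σ)) (ε : ℝ) (r : ℕ) : Prop :=
  ∃ lam : ℝ, 0 < lam ∧ lam ≤ 1 ∧ ∀ D ∈ P, ∀ D' ∈ C,
    histDist d r D D' ≤ lam * min (D.size : ℝ) (D'.size : ℝ) → CloseTo d ε P D'

end RelDB

/-!
The theorem has two independent halves.

**A locality radius exists.** Let `D ∈ P` and let `D' ∈ C` have nearly the same histogram of large
radius. The same randomised local procedure is run on both: in each of `T` rounds every remaining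
element becomes active with probability `1 / 2`, and those connected sets of at most `k` active
elements which are cut off from the other active elements and have a small boundary among the
remaining elements (`IsCell`) are removed as cells. Only the tuples inside cells are kept
(`cellDB`), so the components that result have at most `k` elements.

* If `D` is hyperfinite then most of the remaining elements lie in a component, with small
  boundary, of the partition that hyperfiniteness provides (`card_large_boundary_le`). Such a
  component becomes a cell with probability bounded below, so the expected number of elements left
  over decays geometrically (`expect_card_alive_le`). Removed tuples are charged to boundaries of
  cells and to elements left over (`card_removed_le`).
* The outcome at an element depends only on its coloured neighbourhood of bounded radius
  (`mem_alive_iff_of_localIso`, `LocalIso.cellDB`). Hence the expected number of elements left over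
  and the expected histogram of `cellDB` are determined by the histogram of the database
  (`IsLocalStat.abs_expect_sub_le`); in particular the procedure removes few tuples of `D'` as well,
  although `D'` is not assumed to be hyperfinite.
* Sums of local statistics have variance linear in the size (`IsLocalStat.expect_variance_le`), so
  on large databases a single outcome is simultaneously cheap and typical
  (`exists_partition_near_mean`).
* Two databases with small components are isomorphic up to the deletion of as many elements as
  their histograms differ (`exists_iso_induced_of_small`).

For small databases, nearly equal histograms are equal, and the last point applied to the databases
themselves shows that they are isomorphic.

**Small witnesses.** In a semilinear set every vector can be multiplied by a nonnegative real, up to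
a rounding error that is bounded relative to the factor (`IsSemilinearSet.exists_near_smul`).
Scaling the histogram of a large `D ∈ P` down gives a member of `P` of bounded size with nearly the
same distribution vector. Conversely, if a large `D` has nearly the distribution vector of a member
of `P` of bounded size, scaling that member up to the size of `D` gives a member of `P` whose
histogram is close to that of `D`, so `D` is `ε`-close to `P` by the definition of a locality
radius.
-/

/-! ### Relabelling tuples -/

namespace RelTuple

variable {σ : RelSchema}

/-- The tuple obtained by applying `φ` to every entry. -/
def relabel (φ : ℕ → ℕ) (t : RelTuple σ) : RelTuple σ := ⟨t.1, fun i => φ (t.2 i)⟩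

theorem mem_elems {t : RelTuple σ} {a : ℕ} : a ∈ RelTuple.elems t ↔ ∃ i, t.2 i = a := by
  simp [RelTuple.elems]

theorem elems_nonempty (t : RelTuple σ) : (RelTuple.elems t).Nonempty :=
  ⟨t.2 ⟨0, σ.arity_pos t.1⟩, mem_elems.2 ⟨_, rfl⟩⟩

theorem elems_relabel (φ : ℕ → ℕ) (t : RelTuple σ) :
    RelTuple.elems (relabel φ t) = (RelTuple.elems t).image φ := by
  unfold RelTuple.elems
  rw [Finset.image_image]
  rfl

theorem relabel_relabel (φ ψ : ℕ → ℕ) (t : RelTuple σ) :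
    relabel ψ (relabel φ t) = relabel (fun a => ψ (φ a)) t := rfl

theorem relabel_congr {φ ψ : ℕ → ℕ} {t : RelTuple σ} (h : ∀ a ∈ RelTuple.elems t, φ a = ψ a) :
    relabel φ t = relabel ψ t := by
  unfold relabel
  congr 1
  funext i
  exact h _ (mem_elems.2 ⟨i, rfl⟩)

theorem relabel_eq_self {φ : ℕ → ℕ} {t : RelTuple σ} (h : ∀ a ∈ RelTuple.elems t, φ a = a) :
    relabel φ t = t :=
  (relabel_congr (ψ := id) h).trans rfl

theorem exists_relabel_eq {φ : ℕ → ℕ} {M : Finset ℕ} {t' : RelTuple σ}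
    (h : RelTuple.elems t' ⊆ M.image φ) :
    ∃ t : RelTuple σ, RelTuple.elems t ⊆ M ∧ relabel φ t = t' := by
  have h1 : ∀ i, ∃ x ∈ M, φ x = t'.2 i := fun i =>
    Finset.mem_image.1 (h (mem_elems.2 ⟨i, rfl⟩))
  choose x hx hφ using h1
  refine ⟨⟨t'.1, x⟩, ?_, ?_⟩
  · intro a ha
    obtain ⟨i, rfl⟩ := mem_elems.1 ha
    exact hx i
  · unfold relabel
    simp only [hφ]

theorem card_elems_le (t : RelTuple σ) :
    (RelTuple.elems t).card ≤ Finset.univ.sup σ.arity := by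
  refine Finset.card_image_le.trans ?_
  rw [Finset.card_univ, Fintype.card_fin]
  exact Finset.le_sup (f := σ.arity) (Finset.mem_univ t.1)

end RelTuple

namespace RelDB

open RelTuple

variable {σ : RelSchema}

/-! ### Balls in the Gaifman graph -/

theorem adj_mem_dom {D : RelDB σ} {a b : ℕ} (h : D.gaifman.Adj a b) : a ∈ D.dom ∧ b ∈ D.dom := by
  obtain ⟨-, t, ht, ha, hb⟩ := h
  exact ⟨D.elems_subset t ht ha, D.elems_subset t ht hb⟩

theorem mem_ball {D : RelDB σ} {r a b : ℕ} :
    b ∈ D.ball r a ↔ b ∈ D.dom ∧ D.gaifman.edist a b ≤ r := by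
  classical
  simp [ball]

theorem ball_subset_dom (D : RelDB σ) (r a : ℕ) : D.ball r a ⊆ D.dom := fun _ h => (mem_ball.1 h).1

theorem mem_ball_self {D : RelDB σ} {a : ℕ} (r : ℕ) (ha : a ∈ D.dom) : a ∈ D.ball r a :=
  mem_ball.2 ⟨ha, by simp⟩

theorem ball_mono (D : RelDB σ) {r s : ℕ} (h : r ≤ s) (a : ℕ) : D.ball r a ⊆ D.ball s a :=
  fun _ hb => mem_ball.2 ⟨(mem_ball.1 hb).1, (mem_ball.1 hb).2.trans (by exact_mod_cast h)⟩

theorem mem_ball_comm {D : RelDB σ} {r a b : ℕ} (ha : a ∈ D.dom) (h : b ∈ D.ball r a) :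
    a ∈ D.ball r b :=
  mem_ball.2 ⟨ha, by rw [SimpleGraph.edist_comm]; exact (mem_ball.1 h).2⟩

theorem mem_ball_trans {D : RelDB σ} {r s a b x : ℕ} (hb : b ∈ D.ball r a)
    (hx : x ∈ D.ball s b) : x ∈ D.ball (s + r) a := by
  refine mem_ball.2 ⟨(mem_ball.1 hx).1,
    (SimpleGraph.edist_triangle (G := D.gaifman) (u := a) (v := b) (w := x)).trans ?_⟩
  rw [add_comm, Nat.cast_add]
  exact add_le_add (mem_ball.1 hx).2 (mem_ball.1 hb).2

theorem ball_subset_ball {D : RelDB σ} {r s a b : ℕ} (hb : b ∈ D.ball r a) :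
    D.ball s b ⊆ D.ball (s + r) a := fun _ hx => mem_ball_trans hb hx

theorem ball_zero {D : RelDB σ} {a : ℕ} (ha : a ∈ D.dom) : D.ball 0 a = {a} := by
  ext b
  simp only [mem_ball, Nat.cast_zero, nonpos_iff_eq_zero, SimpleGraph.edist_eq_zero_iff,
    Finset.mem_singleton]
  exact ⟨fun h => h.2.symm, fun h => ⟨h ▸ ha, h.symm⟩⟩

theorem mem_ball_of_adj {D : RelDB σ} {r a x b : ℕ} (hx : x ∈ D.ball r a)
    (h : D.gaifman.Adj x b) : b ∈ D.ball (r + 1) a := by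
  rw [add_comm]
  refine mem_ball_trans hx (mem_ball.2 ⟨(adj_mem_dom h).2, ?_⟩)
  rw [Nat.cast_one, SimpleGraph.edist_le_one_iff_adj_or_eq]
  exact Or.inl h

theorem mem_ball_succ {D : RelDB σ} {r a b : ℕ} :
    b ∈ D.ball (r + 1) a ↔ b ∈ D.ball r a ∨ ∃ x ∈ D.ball r a, D.gaifman.Adj x b := by
  constructor
  · intro h
    obtain ⟨hb, hd⟩ := mem_ball.1 h
    have hne : D.gaifman.edist a b ≠ ⊤ := ne_top_of_le_ne_top (by simp) hd
    obtain ⟨p, hp⟩ := SimpleGraph.exists_walk_of_edist_ne_top hne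
    rw [← hp] at hd
    have hd' : p.length ≤ r + 1 := by exact_mod_cast hd
    by_cases hn : p.Nil
    · left
      have := hn.eq
      subst this
      exact mem_ball_self r hb
    · right
      have hadj := p.adj_penultimate hn
      refine ⟨p.penultimate, mem_ball.2 ⟨(adj_mem_dom hadj).1, ?_⟩, hadj⟩
      refine (SimpleGraph.edist_le p.dropLast).trans ?_
      have hl : p.dropLast.length ≤ r := by
        have := p.length_dropLast_add_one hn
        omega
      exact_mod_cast hl
  · rintro (h | ⟨x, hx, h⟩)
    · exact D.ball_mono (Nat.le_succ r) a h
    · exact mem_ball_of_adj hx h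

theorem elems_subset_ball_one {D : RelDB σ} {t : RelTuple σ} (ht : t ∈ D.tuples) {a : ℕ}
    (ha : a ∈ RelTuple.elems t) : RelTuple.elems t ⊆ D.ball 1 a := by
  intro b hb
  by_cases h : a = b
  · subst h; exact mem_ball_self 1 (D.elems_subset t ht ha)
  · exact mem_ball_of_adj (r := 0) (mem_ball_self 0 (D.elems_subset t ht ha)) ⟨h, t, ht, ha, hb⟩

theorem elems_subset_ball_succ {D : RelDB σ} {t : RelTuple σ} (ht : t ∈ D.tuples) {r a b : ℕ}
    (hb : b ∈ D.ball r a) (hbt : b ∈ RelTuple.elems t) : RelTuple.elems t ⊆ D.ball (r + 1) a := by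
  rw [add_comm]
  exact (elems_subset_ball_one ht hbt).trans (ball_subset_ball hb)

/-! ### Local isomorphisms -/

/-- `φ` restricts to an isomorphism from the `R`-neighbourhood of `a` in `D` to the
`R`-neighbourhood of `φ a` in `E`. -/
structure LocalIso (D E : RelDB σ) (R a : ℕ) (φ : ℕ → ℕ) : Prop where
  inj : Set.InjOn φ (D.ball R a)
  image : (D.ball R a).image φ = E.ball R (φ a)
  mem_iff : ∀ t : RelTuple σ, RelTuple.elems t ⊆ D.ball R a →
    (t ∈ D.tuples ↔ relabel φ t ∈ E.tuples)

/-- A map that preserves adjacency and lifts it, as long as one stays within distance `s` of `b`,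
maps the balls of radius at most `s` around `b` onto balls. -/
theorem image_ball_of_lift {D E : RelDB σ} {φ : ℕ → ℕ} {b : ℕ} (hb : b ∈ D.dom)
    (hb' : φ b ∈ E.dom) (s : ℕ)
    (h1 : ∀ j < s, ∀ x ∈ D.ball j b, ∀ y, D.gaifman.Adj x y → E.gaifman.Adj (φ x) (φ y))
    (h2 : ∀ j < s, ∀ x ∈ D.ball j b, φ x ∈ E.ball j (φ b) → ∀ y', E.gaifman.Adj (φ x) y' →
      ∃ y, D.gaifman.Adj x y ∧ φ y = y') :
    ∀ j ≤ s, (D.ball j b).image φ = E.ball j (φ b) := by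
  intro j
  induction j with
  | zero => intro _; rw [ball_zero hb, ball_zero hb', Finset.image_singleton]
  | succ j ih =>
    intro hj
    have ih' := ih (by omega)
    have hmem : ∀ x ∈ D.ball j b, φ x ∈ E.ball j (φ b) := fun x hx =>
      ih' ▸ Finset.mem_image_of_mem φ hx
    ext y'
    rw [Finset.mem_image]
    constructor
    · rintro ⟨y, hy, rfl⟩
      rcases mem_ball_succ.1 hy with hy | ⟨x, hx, hxy⟩
      · exact E.ball_mono (Nat.le_succ j) _ (hmem y hy)
      · exact mem_ball_of_adj (hmem x hx) (h1 j (by omega) x hx y hxy)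
    · intro hy'
      rcases mem_ball_succ.1 hy' with hy' | ⟨x', hx', hxy'⟩
      · rw [← ih'] at hy'
        obtain ⟨y, hy, rfl⟩ := Finset.mem_image.1 hy'
        exact ⟨y, D.ball_mono (Nat.le_succ j) _ hy, rfl⟩
      · rw [← ih'] at hx'
        obtain ⟨x, hx, rfl⟩ := Finset.mem_image.1 hx'
        obtain ⟨y, hxy, rfl⟩ := h2 j (by omega) x hx (hmem x hx) y' hxy'
        exact ⟨y, mem_ball_of_adj hx hxy, rfl⟩

namespace LocalIso

variable {D E : RelDB σ} {R a : ℕ} {φ : ℕ → ℕ}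

theorem mem_dom (h : LocalIso D E R a φ) (ha : a ∈ D.dom) : φ a ∈ E.dom :=
  E.ball_subset_dom R _ (h.image ▸ Finset.mem_image_of_mem φ (mem_ball_self R ha))

theorem exists_relabel_eq (h : LocalIso D E R a φ) {t' : RelTuple σ} (ht' : t' ∈ E.tuples)
    (hs : RelTuple.elems t' ⊆ E.ball R (φ a)) :
    ∃ t ∈ D.tuples, RelTuple.elems t ⊆ D.ball R a ∧ relabel φ t = t' := by
  rw [← h.image] at hs
  obtain ⟨t, ht, rfl⟩ := RelTuple.exists_relabel_eq hs
  exact ⟨t, (h.mem_iff t ht).2 ht', ht, rfl⟩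

/-- The image of a ball around `b` under a local isomorphism around `a`, provided the ball lies
inside both neighbourhoods. -/
theorem image_ball_aux (h : LocalIso D E R a φ) {s u b : ℕ} (hR : s + u ≤ R)
    (hb : b ∈ D.ball u a) (hb' : φ b ∈ E.ball u (φ a)) :
    ∀ j ≤ s, (D.ball j b).image φ = E.ball j (φ b) := by
  refine image_ball_of_lift (D.ball_subset_dom _ _ hb) (E.ball_subset_dom _ _ hb') s ?_ ?_
  · rintro j hj x hx y ⟨hxy, t, ht, hxt, hyt⟩
    have hsub : RelTuple.elems t ⊆ D.ball R a :=
      (elems_subset_ball_succ ht (mem_ball_trans hb hx) hxt).trans (D.ball_mono (by omega) a)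
    refine ⟨fun he => hxy (h.inj (hsub hxt) (hsub hyt) he), _, (h.mem_iff t hsub).1 ht, ?_, ?_⟩
    · rw [elems_relabel]; exact Finset.mem_image_of_mem φ hxt
    · rw [elems_relabel]; exact Finset.mem_image_of_mem φ hyt
  · rintro j hj x hx hx' y' ⟨hxy', t', ht', hxt', hyt'⟩
    have hsub' : RelTuple.elems t' ⊆ E.ball R (φ a) :=
      (elems_subset_ball_succ ht' (mem_ball_trans hb' hx') hxt').trans (E.ball_mono (by omega) _)
    obtain ⟨t, ht, hsub, rfl⟩ := h.exists_relabel_eq ht' hsub'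
    rw [elems_relabel] at hxt' hyt'
    obtain ⟨z, hz, hzx⟩ := Finset.mem_image.1 hxt'
    obtain ⟨y, hy, rfl⟩ := Finset.mem_image.1 hyt'
    have hxR : x ∈ D.ball R a := D.ball_mono (by omega) a (mem_ball_trans hb hx)
    obtain rfl := h.inj (hsub hz) hxR hzx
    exact ⟨y, ⟨fun he => hxy' (congrArg φ he), t, ht, hz, hy⟩, rfl⟩

theorem image_ball (h : LocalIso D E R a φ) (ha : a ∈ D.dom) {j : ℕ} (hj : j ≤ R) :
    (D.ball j a).image φ = E.ball j (φ a) :=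
  h.image_ball_aux (s := R) (u := 0) le_rfl (mem_ball_self 0 ha)
    (mem_ball_self 0 (h.mem_dom ha)) j hj

theorem restrict (h : LocalIso D E R a φ) (ha : a ∈ D.dom) {s u b : ℕ} (hR : s + u ≤ R)
    (hb : b ∈ D.ball u a) : LocalIso D E s b φ := by
  have hsub : D.ball s b ⊆ D.ball R a := (ball_subset_ball hb).trans (D.ball_mono hR a)
  refine ⟨h.inj.mono (by exact_mod_cast hsub), ?_, fun t ht => h.mem_iff t (ht.trans hsub)⟩
  refine h.image_ball_aux hR hb ?_ s le_rfl
  rw [← h.image_ball ha (j := u) (by omega)]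
  exact Finset.mem_image_of_mem φ hb

theorem mono (h : LocalIso D E R a φ) (ha : a ∈ D.dom) {s : ℕ} (hs : s ≤ R) :
    LocalIso D E s a φ :=
  h.restrict ha (u := 0) hs (mem_ball_self 0 ha)

theorem symm (h : LocalIso D E R a φ) (ha : a ∈ D.dom) :
    ∃ ψ : ℕ → ℕ, LocalIso E D R (φ a) ψ ∧ ∀ x ∈ D.ball R a, ψ (φ x) = x := by
  have hinv : ∀ x ∈ D.ball R a, Function.invFunOn φ (D.ball R a) (φ x) = x := fun x hx =>
    h.inj.leftInvOn_invFunOn hx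
  refine ⟨Function.invFunOn φ (D.ball R a), ⟨?_, ?_, ?_⟩, hinv⟩
  · rw [← h.image]
    intro x' hx' y' hy' hxy
    obtain ⟨x, hx, rfl⟩ := Finset.mem_image.1 (Finset.mem_coe.1 hx')
    obtain ⟨y, hy, rfl⟩ := Finset.mem_image.1 (Finset.mem_coe.1 hy')
    rw [hinv x hx, hinv y hy] at hxy
    rw [hxy]
  · rw [hinv a (mem_ball_self R ha), ← h.image, Finset.image_image]
    ext x
    rw [Finset.mem_image]
    constructor
    · rintro ⟨y, hy, rfl⟩
      rwa [Function.comp_apply, hinv y hy]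
    · exact fun hx => ⟨x, hx, hinv x hx⟩
  · intro t' ht'
    rw [← h.image] at ht'
    obtain ⟨t, ht, rfl⟩ := RelTuple.exists_relabel_eq ht'
    rw [relabel_relabel, relabel_eq_self (fun x hx => hinv x (ht hx))]
    exact (h.mem_iff t ht).symm

end LocalIso

theorem localIso_id (D : RelDB σ) (R a : ℕ) : LocalIso D D R a id :=
  ⟨Function.injective_id.injOn, Finset.image_id, fun _ _ => Iff.rfl⟩

theorem dom_induced_ball (D : RelDB σ) (r a : ℕ) : (D.induced (D.ball r a)).dom = D.ball r a :=
  Finset.inter_eq_right.2 (D.ball_subset_dom r a)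

theorem mem_tuples_induced {D : RelDB σ} {M : Finset ℕ} {t : RelTuple σ} :
    t ∈ (D.induced M).tuples ↔ t ∈ D.tuples ∧ RelTuple.elems t ⊆ M := by
  simp [induced]

theorem exists_iso_of_injOn {D E : RelDB σ} {φ : ℕ → ℕ} (hinj : Set.InjOn φ D.dom)
    (himg : D.dom.image φ = E.dom)
    (hmem : ∀ t : RelTuple σ, RelTuple.elems t ⊆ D.dom →
      (t ∈ D.tuples ↔ relabel φ t ∈ E.tuples)) :
    ∃ e : Iso D E, ∀ x : D.dom, (e.toEquiv x : ℕ) = φ x := by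
  have hmaps : ∀ x : D.dom, φ x ∈ E.dom := fun x => himg ▸ Finset.mem_image_of_mem φ x.2
  let f : D.dom → E.dom := fun x => ⟨φ x, hmaps x⟩
  have hf : Function.Bijective f := by
    constructor
    · intro x y hxy
      exact Subtype.ext (hinj x.2 y.2 (congrArg Subtype.val hxy))
    · intro y
      obtain ⟨x, hx, hxy⟩ := Finset.mem_image.1 (Finset.ext_iff.1 himg y |>.2 y.2)
      exact ⟨⟨x, hx⟩, Subtype.ext hxy⟩
  refine ⟨⟨Equiv.ofBijective f hf, fun R t => ?_⟩, fun x => rfl⟩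
  refine hmem ⟨R, fun i => (t i : ℕ)⟩ ?_
  intro a ha
  obtain ⟨i, rfl⟩ := mem_elems.1 ha
  exact (t i).2

/-- Two elements have the same `R`-type if and only if some local isomorphism maps one to the
other. -/
theorem typeOf_eq_iff {D E : RelDB σ} {R : ℕ} {a : D.dom} {b : E.dom} :
    D.typeOf R a = E.typeOf R b ↔ ∃ φ : ℕ → ℕ, φ a = b ∧ LocalIso D E R a φ := by
  unfold typeOf
  rw [Quotient.eq]
  constructor
  · rintro ⟨e, he⟩
    change Iso (D.induced (D.ball R a)) (E.induced (E.ball R b)) at e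
    classical
    let φ : ℕ → ℕ := fun x =>
      if h : x ∈ (D.induced (D.ball R a)).dom then (e.toEquiv ⟨x, h⟩ : ℕ) else 0
    have hφ : ∀ x : (D.induced (D.ball R a)).dom, φ x = e.toEquiv x := fun x => by
      simp only [φ, x.2, dif_pos]
    have hφa : φ a = b := (hφ ⟨a, (D.neighbourhood R a).centre_mem⟩).trans he
    refine ⟨φ, hφa, ?_, ?_, ?_⟩
    · rw [← dom_induced_ball]
      intro x hx y hy hxy
      have h := (hφ ⟨x, hx⟩).symm.trans (hxy.trans (hφ ⟨y, hy⟩))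
      exact congrArg Subtype.val (e.toEquiv.injective (Subtype.ext h))
    · rw [hφa, ← dom_induced_ball, ← dom_induced_ball E]
      ext y
      rw [Finset.mem_image]
      constructor
      · rintro ⟨x, hx, rfl⟩
        rw [hφ ⟨x, hx⟩]
        exact (e.toEquiv ⟨x, hx⟩).2
      · intro hy
        obtain ⟨x, hx⟩ := e.toEquiv.surjective ⟨y, hy⟩
        exact ⟨x, x.2, by rw [hφ x, hx]⟩
    · intro t ht
      have ht' : ∀ i, t.2 i ∈ (D.induced (D.ball R a)).dom := fun i => by
        rw [dom_induced_ball]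
        exact ht (mem_elems.2 ⟨i, rfl⟩)
      have h := e.mem_iff t.1 (fun i => ⟨t.2 i, ht' i⟩)
      rw [mem_tuples_induced, mem_tuples_induced] at h
      have h1 : (⟨t.1, fun i => (e.toEquiv ⟨t.2 i, ht' i⟩ : ℕ)⟩ : RelTuple σ) = relabel φ t := by
        unfold relabel
        congr 1
        funext i
        exact (hφ ⟨t.2 i, ht' i⟩).symm
      rw [h1] at h
      have h2 : RelTuple.elems (relabel φ t) ⊆ E.ball R b := by
        intro y hy
        obtain ⟨i, rfl⟩ := mem_elems.1 hy
        rw [← dom_induced_ball]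
        change φ (t.2 i) ∈ _
        rw [hφ ⟨t.2 i, ht' i⟩]
        exact (e.toEquiv ⟨t.2 i, ht' i⟩).2
      exact ⟨fun hD => (h.1 ⟨hD, ht⟩).1, fun hE => (h.2 ⟨hE, h2⟩).1⟩
  · rintro ⟨φ, hφ, hl⟩
    have hb : E.ball R (φ a) = E.ball R b := by rw [hφ]
    obtain ⟨e, he⟩ := exists_iso_of_injOn (D := D.induced (D.ball R a))
      (E := E.induced (E.ball R b)) (φ := φ)
      (by rw [dom_induced_ball]; exact hl.inj)
      (by rw [dom_induced_ball, dom_induced_ball, hl.image, hb]) (fun t ht => by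
        rw [dom_induced_ball] at ht
        rw [mem_tuples_induced, mem_tuples_induced, elems_relabel, hl.mem_iff t ht]
        have : (RelTuple.elems t).image φ ⊆ E.ball R b := by
          rw [← hb, ← hl.image]
          exact Finset.image_subset_image ht
        simp only [ht, this, and_true])
    exact ⟨e, (he _).trans hφ⟩

/-! ### Size of balls and finiteness of the set of types -/

/-- A bound on the number of elements of an `r`-ball in a database of degree at most `d`. -/
def ballBound (σ : RelSchema) (d r : ℕ) : ℕ := (1 + d * Finset.univ.sup σ.arity) ^ r

theorem card_ball_one_le {D : RelDB σ} {d : ℕ} (hD : D.DegreeLE d) {a : ℕ} (ha : a ∈ D.dom) :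
    (D.ball 1 a).card ≤ 1 + d * Finset.univ.sup σ.arity := by
  classical
  have hsub : D.ball 1 a ⊆
      insert a ((D.tuples.filter (fun t => a ∈ RelTuple.elems t)).biUnion RelTuple.elems) := by
    intro b hb
    rw [← zero_add 1, mem_ball_succ, ball_zero ha] at hb
    rcases hb with hb | ⟨x, hx, -, t, ht, hxt, hbt⟩
    · rw [Finset.mem_singleton.1 hb]; exact Finset.mem_insert_self _ _
    · rw [Finset.mem_singleton.1 hx] at hxt
      exact Finset.mem_insert_of_mem
        (Finset.mem_biUnion.2 ⟨t, Finset.mem_filter.2 ⟨ht, hxt⟩, hbt⟩)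
  refine (Finset.card_le_card hsub).trans ((Finset.card_insert_le _ _).trans ?_)
  have h1 := Finset.card_biUnion_le_card_mul
    (D.tuples.filter (fun t => a ∈ RelTuple.elems t)) RelTuple.elems
    (Finset.univ.sup σ.arity) (fun t _ => card_elems_le t)
  have h2 := Nat.mul_le_mul_right (Finset.univ.sup σ.arity) (hD a ha)
  unfold degree at h2
  omega

theorem card_ball_le {D : RelDB σ} {d : ℕ} (hD : D.DegreeLE d) {a : ℕ} (ha : a ∈ D.dom) (r : ℕ) :
    (D.ball r a).card ≤ ballBound σ d r := by
  classical
  induction r with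
  | zero => rw [ball_zero ha]; simp [ballBound]
  | succ r ih =>
    have hsub : D.ball (r + 1) a ⊆ (D.ball r a).biUnion (D.ball 1) := by
      intro b hb
      rw [Finset.mem_biUnion]
      rcases mem_ball_succ.1 hb with h | ⟨x, hx, h⟩
      · exact ⟨b, h, mem_ball_self 1 (D.ball_subset_dom r a h)⟩
      · exact ⟨x, hx, mem_ball_of_adj (r := 0) (mem_ball_self 0 (D.ball_subset_dom r a hx)) h⟩
    refine (Finset.card_le_card hsub).trans ((Finset.card_biUnion_le_card_mul _ _ _
      fun x hx => card_ball_one_le hD (D.ball_subset_dom r a hx)).trans ?_)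
    unfold ballBound at ih ⊢
    rw [pow_succ]
    exact Nat.mul_le_mul_right _ ih

/-- Every database is isomorphic to one whose domain is an initial segment of `ℕ`. -/
theorem exists_iso_dom_subset_range (D : RelDB σ) :
    ∃ E : RelDB σ, E.dom ⊆ Finset.range D.dom.card ∧ Nonempty (Iso D E) := by
  classical
  let φ : ℕ → ℕ := fun x => if h : x ∈ D.dom then (D.dom.equivFin ⟨x, h⟩ : ℕ) else 0
  have hφ : ∀ x : D.dom, φ x = D.dom.equivFin x := fun x => by simp only [φ, x.2, dif_pos]
  have hinj : Set.InjOn φ D.dom := by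
    intro x hx y hy hxy
    have h := (hφ ⟨x, hx⟩).symm.trans (hxy.trans (hφ ⟨y, hy⟩))
    exact congrArg Subtype.val (D.dom.equivFin.injective (Fin.ext h))
  let E : RelDB σ :=
    { dom := D.dom.image φ
      tuples := D.tuples.image (relabel φ)
      elems_subset := by
        intro t' ht'
        obtain ⟨t, ht, rfl⟩ := Finset.mem_image.1 ht'
        rw [elems_relabel]
        exact Finset.image_subset_image (D.elems_subset t ht) }
  refine ⟨E, ?_, ?_⟩
  · intro y hy
    obtain ⟨x, hx, rfl⟩ := Finset.mem_image.1 hy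
    rw [hφ ⟨x, hx⟩, Finset.mem_range]
    exact (D.dom.equivFin ⟨x, hx⟩).2
  · refine (exists_iso_of_injOn (E := E) hinj rfl fun t ht => ?_).nonempty
    refine ⟨fun h => Finset.mem_image_of_mem _ h, fun h => ?_⟩
    obtain ⟨s, hs, hst⟩ := Finset.mem_image.1 h
    have h1 := congrArg (relabel (Function.invFunOn φ D.dom)) hst
    rw [relabel_relabel, relabel_relabel,
      relabel_eq_self (fun x hx => hinj.leftInvOn_invFunOn (D.elems_subset s hs hx)),
      relabel_eq_self (fun x hx => hinj.leftInvOn_invFunOn (ht hx))] at h1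
    exact h1 ▸ hs

theorem finite_pointed_subset_range (σ : RelSchema) (N : ℕ) :
    {A : Pointed σ | A.db.dom ⊆ Finset.range N}.Finite := by
  classical
  let T : Finset (RelTuple σ) :=
    Finset.univ.sigma (fun R => Fintype.piFinset (fun _ : Fin (σ.arity R) => Finset.range N))
  let S : Finset (Finset ℕ × Finset (RelTuple σ) × ℕ) :=
    (Finset.range N).powerset ×ˢ T.powerset ×ˢ Finset.range N
  refine Set.Finite.of_finite_image (f := fun A : Pointed σ => (A.db.dom, A.db.tuples, A.centre))
    (S.finite_toSet.subset ?_) ?_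
  · rintro _ ⟨A, hA, rfl⟩
    simp only [S, Finset.coe_product, Set.mem_prod, Finset.mem_coe, Finset.mem_powerset]
    refine ⟨hA, fun t ht => ?_, hA A.centre_mem⟩
    simp only [T, Finset.mem_sigma, Finset.mem_univ, true_and, Fintype.mem_piFinset]
    exact fun i => hA (A.db.elems_subset t ht (mem_elems.2 ⟨i, rfl⟩))
  · rintro ⟨⟨dom, tup, h⟩, c, hc⟩ - ⟨⟨dom', tup', h'⟩, c', hc'⟩ - he
    simp only [Prod.mk.injEq] at he
    obtain ⟨rfl, rfl, rfl⟩ := he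
    rfl

instance finite_rType (σ : RelSchema) (d r : ℕ) : Finite (RType σ d r) := by
  have hfin := (finite_pointed_subset_range σ (ballBound σ d r)).image
    (fun A => (Quotient.mk (pointedSetoid σ) A))
  refine (hfin.subset ?_).to_subtype
  rintro τ ⟨D, a, hD, rfl⟩
  obtain ⟨E, hE, ⟨e⟩⟩ := exists_iso_dom_subset_range (D.induced (D.ball r a))
  rw [dom_induced_ball] at hE
  refine ⟨⟨E, e.toEquiv ⟨a, (D.neighbourhood r a).centre_mem⟩, Subtype.prop _⟩,
    hE.trans (Finset.range_subset_range.2 (card_ball_le hD a.2 r)), ?_⟩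
  refine (Quotient.sound (a := D.neighbourhood r a) ?_).symm
  exact ⟨e, rfl⟩

noncomputable instance fintypeRType (σ : RelSchema) (d r : ℕ) : Fintype (RType σ d r) :=
  Fintype.ofFinite _

/-! ### Histograms -/

/-- The type of an element, as an element of the finite type of `r`-types of degree at most
`d`. -/
noncomputable def rtype {d : ℕ} (D : RelDB σ) (hD : D.DegreeLE d) (r : ℕ) (a : D.dom) :
    RType σ d r := ⟨D.typeOf r a, D, a, hD, rfl⟩

theorem rtype_eq_iff {d : ℕ} {D : RelDB σ} (hD : D.DegreeLE d) {r : ℕ} {a : D.dom}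
    {τ : RType σ d r} : D.rtype hD r a = τ ↔ D.typeOf r a = τ.1 :=
  Subtype.ext_iff

theorem histDist_eq_sum (d r : ℕ) (D E : RelDB σ) :
    histDist d r D E = ∑ τ : RType σ d r, |(D.hist d r τ : ℝ) - (E.hist d r τ : ℝ)| :=
  finsum_eq_sum_of_fintype _

theorem dvDist_eq_sum (d r : ℕ) (D E : RelDB σ) :
    dvDist d r D E = ∑ τ : RType σ d r, |D.dv d r τ - E.dv d r τ| :=
  finsum_eq_sum_of_fintype _

theorem histDist_comm (d r : ℕ) (D E : RelDB σ) : histDist d r D E = histDist d r E D := by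
  simp only [histDist_eq_sum, abs_sub_comm]

/-- Summing a function of the type over all elements. -/
theorem sum_rtype {d : ℕ} {D : RelDB σ} (hD : D.DegreeLE d) (r : ℕ) (w : RType σ d r → ℝ) :
    ∑ a : D.dom, w (D.rtype hD r a) = ∑ τ, (D.hist d r τ : ℝ) * w τ := by
  classical
  rw [← Finset.sum_fiberwise (s := Finset.univ) (g := fun a => D.rtype hD r a)]
  refine Finset.sum_congr rfl fun τ _ => ?_
  rw [Finset.sum_congr rfl (g := fun _ => w τ)
    (fun a ha => by rw [(Finset.mem_filter.1 ha).2]), Finset.sum_const, nsmul_eq_mul]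
  congr 2
  unfold hist
  congr 1
  ext a
  rw [Finset.mem_filter, Finset.mem_filter, rtype_eq_iff]

theorem sum_hist {d : ℕ} {D : RelDB σ} (hD : D.DegreeLE d) (r : ℕ) :
    ∑ τ : RType σ d r, (D.hist d r τ : ℝ) = D.size := by
  have h := sum_rtype hD r (fun _ => 1)
  simp only [mul_one] at h
  rw [← h]
  simp [size]

/-- Sums over all elements of a function of the type with values in `[-1, 1]` differ by at
most the distance of the histograms. -/
theorem abs_sum_rtype_sub_le {d : ℕ} {D E : RelDB σ} (hD : D.DegreeLE d) (hE : E.DegreeLE d)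
    (r : ℕ) (w : RType σ d r → ℝ) (hw : ∀ τ, |w τ| ≤ 1) :
    |∑ a : D.dom, w (D.rtype hD r a) - ∑ a : E.dom, w (E.rtype hE r a)| ≤ histDist d r D E := by
  rw [sum_rtype, sum_rtype, ← Finset.sum_sub_distrib, histDist_eq_sum]
  refine (Finset.abs_sum_le_sum_abs _ _).trans (Finset.sum_le_sum fun τ _ => ?_)
  rw [← sub_mul, abs_mul]
  exact mul_le_of_le_one_right (abs_nonneg _) (hw τ)

theorem abs_size_sub_le {d : ℕ} {D E : RelDB σ} (hD : D.DegreeLE d) (hE : E.DegreeLE d) (r : ℕ) :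
    |(D.size : ℝ) - E.size| ≤ histDist d r D E := by
  have h := abs_sum_rtype_sub_le hD hE r (fun _ => 1) (by simp)
  simpa [size] using h

/-! ### Databases with small components -/

theorem ball_eq_of_ball_succ_eq {D : RelDB σ} {r a : ℕ} (h : D.ball (r + 1) a = D.ball r a)
    (j : ℕ) : D.ball (r + j) a = D.ball r a := by
  induction j with
  | zero => rfl
  | succ j ih =>
    ext b
    rw [← add_assoc, mem_ball_succ, ih, ← mem_ball_succ, h]

theorem ball_succ_eq_of_card_le {D : RelDB σ} {r a : ℕ} (ha : a ∈ D.dom)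
    (h : (D.ball (r + 1) a).card ≤ r + 1) : D.ball (r + 1) a = D.ball r a := by
  by_contra hne
  have hgrow : ∀ j ≤ r + 1, j + 1 ≤ (D.ball j a).card := by
    intro j
    induction j with
    | zero => intro _; rw [ball_zero ha]; simp
    | succ j ih =>
      intro hj
      have hlt : D.ball j a ⊂ D.ball (j + 1) a := by
        refine (D.ball_mono (Nat.le_succ j) a).ssubset_of_ne fun he => hne ?_
        have h1 := ball_eq_of_ball_succ_eq he.symm (r - j)
        have h2 := ball_eq_of_ball_succ_eq he.symm (r + 1 - j)
        rw [show j + (r - j) = r by omega] at h1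
        rw [show j + (r + 1 - j) = r + 1 by omega] at h2
        rw [h1, h2]
      have := Finset.card_lt_card hlt
      have := ih (by omega)
      omega
  have := hgrow (r + 1) le_rfl
  omega

/-- If all balls have at most `r` elements then the `r`-ball of an element is its whole
component. -/
theorem ball_eq_of_mem_ball {D : RelDB σ} {r : ℕ}
    (h : ∀ a ∈ D.dom, (D.ball (r + 1) a).card ≤ r) {a b : ℕ} (ha : a ∈ D.dom)
    (hb : b ∈ D.ball r a) : D.ball r b = D.ball r a := by
  have key : ∀ x ∈ D.dom, ∀ y ∈ D.ball r x, D.ball r y ⊆ D.ball r x := fun x hx y hy => by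
    have := ball_subset_ball (s := r) hy
    rwa [ball_eq_of_ball_succ_eq
      (ball_succ_eq_of_card_le hx ((h x hx).trans (Nat.le_succ r)))] at this
  exact (key a ha b hb).antisymm (key b (D.ball_subset_dom _ _ hb) a (mem_ball_comm ha hb))

/-- Two databases of degree at most `d` all of whose components are small become isomorphic after
the deletion of as many elements as their histograms differ: a maximal partial isomorphism between
unions of components leaves no type unmatched on both sides. -/
theorem exists_iso_induced_of_small {d r : ℕ} (hr : 1 ≤ r) {F G : RelDB σ} (hF : F.DegreeLE d)
    (hG : G.DegreeLE d) (hFc : ∀ a ∈ F.dom, (F.ball (r + 1) a).card ≤ r)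
    (hGc : ∀ a ∈ G.dom, (G.ball (r + 1) a).card ≤ r) :
    ∃ A ⊆ F.dom, ∃ B ⊆ G.dom, Nonempty (Iso (F.induced A) (G.induced B)) ∧
      (((F.dom \ A).card + (G.dom \ B).card : ℕ) : ℝ) ≤ histDist d r F G := by
  classical
  let Good : Finset ℕ → (ℕ → ℕ) → Prop := fun A φ =>
    Set.InjOn φ A ∧ ∀ b ∈ A, F.ball r b ⊆ A ∧ LocalIso F G r b φ
  obtain ⟨A, hA, hmax⟩ := Finset.exists_max_image
    (F.dom.powerset.filter (fun A => ∃ φ, Good A φ)) Finset.card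
    ⟨∅, by simp [Good]⟩
  simp only [Finset.mem_filter, Finset.mem_powerset] at hA hmax
  obtain ⟨hAF, φ, hinj, hloc⟩ := hA
  have hBG : A.image φ ⊆ G.dom := by
    intro y hy
    obtain ⟨x, hx, rfl⟩ := Finset.mem_image.1 hy
    exact (hloc x hx).2.mem_dom (hAF hx)
  -- By maximality, no element outside `A` has the type of an element outside the image of `A`.
  have hno : ∀ (a : F.dom) (b : G.dom), (a : ℕ) ∉ A → (b : ℕ) ∉ A.image φ →
      F.typeOf r a ≠ G.typeOf r b := by
    intro a b ha hb hab
    obtain ⟨ψ, hψ, hl⟩ := typeOf_eq_iff.1 hab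
    have hSb : ∀ x ∈ F.ball r a, F.ball r x = F.ball r a := fun x hx =>
      ball_eq_of_mem_ball hFc a.2 hx
    -- The component of `a` is matched with that of `b` by `ψ`, which extends `φ`.
    have hdisj : ∀ x ∈ F.ball r a, x ∉ A := fun x hx hxA =>
      ha ((hloc x hxA).1 (mem_ball_comm a.2 hx))
    have hdisj' : ∀ x ∈ F.ball r a, ∀ y ∈ A, ψ x ≠ φ y := by
      intro x hx y hy he
      have h1 : φ y ∈ G.ball r b := by
        rw [← he, ← hψ, ← hl.image]
        exact Finset.mem_image_of_mem ψ hx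
      have h2 := mem_ball_comm b.2 h1
      rw [← (hloc y hy).2.image] at h2
      exact hb (Finset.image_subset_image (hloc y hy).1 h2)
    let χ : ℕ → ℕ := fun x => if x ∈ F.ball r a then ψ x else φ x
    have hχS : ∀ x ∈ F.ball r a, χ x = ψ x := fun x hx => if_pos hx
    have hχA : ∀ x ∈ A, χ x = φ x := fun x hx => if_neg fun h => hdisj x h hx
    have hcongr : ∀ x (θ : ℕ → ℕ), x ∈ F.dom → (∀ y ∈ F.ball r x, χ y = θ y) →
        LocalIso F G r x θ → LocalIso F G r x χ := by
      intro x θ hx hy h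
      refine ⟨h.inj.congr fun y hy' => (hy y hy').symm, ?_, fun t ht => ?_⟩
      · rw [hy x (mem_ball_self r hx), ← h.image]
        exact Finset.image_congr fun y hy' => hy y hy'
      · rw [relabel_congr fun y hy' => hy y (ht hy')]
        exact h.mem_iff t ht
    have hgood : Good (F.ball r a ∪ A) χ := by
      constructor
      · intro x hx y hy hxy
        simp only [Finset.coe_union, Set.mem_union, Finset.mem_coe] at hx hy
        rcases hx with hx | hx <;> rcases hy with hy | hy
        · rw [hχS x hx, hχS y hy] at hxy
          exact hl.inj hx hy hxy
        · rw [hχS x hx, hχA y hy] at hxy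
          exact absurd hxy (hdisj' x hx y hy)
        · rw [hχA x hx, hχS y hy] at hxy
          exact absurd hxy.symm (hdisj' y hy x hx)
        · rw [hχA x hx, hχA y hy] at hxy
          exact hinj hx hy hxy
      · intro x hx
        rcases Finset.mem_union.1 hx with hx | hx
        · refine ⟨(hSb x hx).subset.trans Finset.subset_union_left,
            hcongr x ψ (F.ball_subset_dom _ _ hx) (fun y hy => hχS y (hSb x hx ▸ hy)) ?_⟩
          have h1 : ψ x ∈ G.ball r (ψ a) := hl.image ▸ Finset.mem_image_of_mem ψ hx
          refine ⟨by rw [hSb x hx]; exact hl.inj, ?_, fun t ht => hl.mem_iff t (hSb x hx ▸ ht)⟩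
          rw [hSb x hx, hl.image, ball_eq_of_mem_ball hGc (hl.mem_dom a.2) h1]
        · exact ⟨(hloc x hx).1.trans Finset.subset_union_right,
            hcongr x φ (hAF hx) (fun y hy => hχA y ((hloc x hx).1 hy)) (hloc x hx).2⟩
    have hle := hmax (F.ball r a ∪ A)
      ⟨Finset.union_subset (F.ball_subset_dom _ _) hAF, χ, hgood⟩
    have hlt : A ⊂ F.ball r a ∪ A := Finset.ssubset_iff_subset_ne.2
      ⟨Finset.subset_union_right, fun he =>
        ha (he.symm ▸ Finset.mem_union_left A (mem_ball_self r a.2))⟩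
    exact absurd (Finset.card_lt_card hlt) (not_lt.2 hle)
  refine ⟨A, hAF, A.image φ, hBG, ?_, ?_⟩
  · refine (exists_iso_of_injOn (φ := φ) ?_ ?_ fun t ht => ?_).nonempty
    · exact hinj.mono (by simp [induced])
    · simp only [induced, Finset.inter_eq_right.2 hAF, Finset.inter_eq_right.2 hBG]
    · have hdA : (F.induced A).dom = A := Finset.inter_eq_right.2 hAF
      rw [hdA] at ht
      rw [mem_tuples_induced, mem_tuples_induced, elems_relabel]
      obtain ⟨x, hx⟩ := elems_nonempty t
      have hlx := (hloc x (ht hx)).2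
      have himg := Finset.image_subset_image (f := φ) ht
      constructor
      · rintro ⟨h, -⟩
        refine ⟨(hlx.mem_iff t ?_).1 h, himg⟩
        exact (elems_subset_ball_one h hx).trans (F.ball_mono hr x)
      · rintro ⟨h, -⟩
        have hx' : φ x ∈ RelTuple.elems (relabel φ t) := by
          rw [elems_relabel]; exact Finset.mem_image_of_mem φ hx
        have hs := (elems_subset_ball_one h hx').trans (G.ball_mono hr _)
        rw [elems_relabel, ← hlx.image] at hs
        refine ⟨(hlx.mem_iff t fun y hy => ?_).2 h, ht⟩
        obtain ⟨z, hz, hzy⟩ := Finset.mem_image.1 (hs (Finset.mem_image_of_mem φ hy))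
        rwa [← hinj ((hloc x (ht hx)).1 hz) (ht hy) hzy]
  · have hcard : ∀ (H : RelDB σ) (X : Finset ℕ) (hH : H.DegreeLE d), (H.dom \ X).card =
        ∑ τ : RType σ d r,
          (Finset.univ.filter (fun a : H.dom => H.typeOf r a = τ.1 ∧ (a : ℕ) ∉ X)).card := by
      intro H X hH
      have h1 : (H.dom \ X).card = (Finset.univ.filter (fun a : H.dom => (a : ℕ) ∉ X)).card := by
        rw [← Finset.card_image_of_injective _ Subtype.val_injective]
        congr 1
        ext x
        simp [and_comm]
      rw [h1, Finset.card_eq_sum_card_fiberwise (f := fun a => H.rtype hH r a)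
        (t := Finset.univ) (fun _ _ => Finset.mem_coe.2 (Finset.mem_univ _))]
      refine Finset.sum_congr rfl fun τ _ => ?_
      rw [Finset.filter_filter]
      congr 1
      ext a
      rw [Finset.mem_filter, Finset.mem_filter, rtype_eq_iff, and_comm (a := _ ∉ X)]
    have hsplit : ∀ (H : RelDB σ) (X : Finset ℕ) (τ : RType σ d r), H.hist d r τ =
        (Finset.univ.filter (fun a : H.dom => H.typeOf r a = τ.1 ∧ (a : ℕ) ∈ X)).card +
        (Finset.univ.filter (fun a : H.dom => H.typeOf r a = τ.1 ∧ (a : ℕ) ∉ X)).card := by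
      intro H X τ
      rw [← Finset.filter_filter, ← Finset.filter_filter, Finset.card_filter_add_card_filter_not]
      unfold hist
      congr!
    rw [hcard F A hF, hcard G _ hG, ← Finset.sum_add_distrib, histDist_eq_sum, Nat.cast_sum]
    refine Finset.sum_le_sum fun τ _ => ?_
    rw [hsplit F A τ, hsplit G (A.image φ) τ]
    have hmatch : (Finset.univ.filter
          (fun a : F.dom => F.typeOf r a = τ.1 ∧ (a : ℕ) ∈ A)).card =
        (Finset.univ.filter
          (fun a : G.dom => G.typeOf r a = τ.1 ∧ (a : ℕ) ∈ A.image φ)).card := by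
      have htype : ∀ (a : F.dom) (ha : (a : ℕ) ∈ A),
          F.typeOf r a = G.typeOf r ⟨φ a, hBG (Finset.mem_image_of_mem φ ha)⟩ := fun a ha =>
        typeOf_eq_iff.2 ⟨φ, rfl, (hloc a ha).2⟩
      refine Finset.card_bij (fun a ha => ⟨φ a, hBG (Finset.mem_image_of_mem φ
        (Finset.mem_filter.1 ha).2.2)⟩) ?_ ?_ ?_
      · intro a ha
        obtain ⟨-, ha1, ha2⟩ := Finset.mem_filter.1 ha
        refine Finset.mem_filter.2 ⟨Finset.mem_univ _, ?_, Finset.mem_image_of_mem φ ha2⟩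
        rw [← htype a ha2, ha1]
      · intro a ha b hb hab
        exact Subtype.ext (hinj (Finset.mem_filter.1 ha).2.2 (Finset.mem_filter.1 hb).2.2
          (congrArg Subtype.val hab))
      · intro b hb
        obtain ⟨-, hb1, hb2⟩ := Finset.mem_filter.1 hb
        obtain ⟨x, hx, hxb⟩ := Finset.mem_image.1 hb2
        refine ⟨⟨x, hAF hx⟩, Finset.mem_filter.2 ⟨Finset.mem_univ _, ?_, hx⟩, Subtype.ext hxb⟩
        rw [htype ⟨x, hAF hx⟩ hx, ← hb1]
        congr 1
        exact Subtype.ext hxb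
    rw [hmatch]
    -- One of the two remainders vanishes, so their sum is the absolute difference.
    have hz : (Finset.univ.filter
          (fun a : F.dom => F.typeOf r a = τ.1 ∧ (a : ℕ) ∉ A)).card = 0 ∨
        (Finset.univ.filter
          (fun a : G.dom => G.typeOf r a = τ.1 ∧ (a : ℕ) ∉ A.image φ)).card = 0 := by
      by_contra! h
      obtain ⟨a, ha⟩ := Finset.card_pos.1 (Nat.pos_of_ne_zero h.1)
      obtain ⟨b, hb⟩ := Finset.card_pos.1 (Nat.pos_of_ne_zero h.2)
      obtain ⟨-, ha1, ha2⟩ := Finset.mem_filter.1 ha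
      obtain ⟨-, hb1, hb2⟩ := Finset.mem_filter.1 hb
      exact hno a b ha2 hb2 (ha1.trans hb1.symm)
    push_cast
    rw [add_sub_add_left_eq_sub]
    rcases hz with hz | hz
    · rw [hz, abs_sub_comm]; simp
    · rw [hz]; simp

/-! ### Counting modifications -/

theorem ModSteps.trans {m n : ℕ} {D E F : RelDB σ} (h : ModSteps m D E) (h' : ModSteps n E F) :
    ModSteps (m + n) D F := by
  induction h with
  | refl D => rwa [zero_add]
  | step h _ ih => rw [Nat.add_right_comm]; exact ModSteps.step h (ih h')

theorem ext_dom_tuples {D E : RelDB σ} (h1 : D.dom = E.dom) (h2 : D.tuples = E.tuples) :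
    D = E := by
  cases D; cases E; cases h1; cases h2; rfl

theorem IsTupleRemoval.modSteps {D E : RelDB σ} (h : IsTupleRemoval D E) :
    ModSteps (D.tuples \ E.tuples).card D E := by
  classical
  generalize hn : (D.tuples \ E.tuples).card = n
  induction n generalizing D with
  | zero =>
    have h1 : D.tuples ⊆ E.tuples := Finset.sdiff_eq_empty_iff_subset.1 (Finset.card_eq_zero.1 hn)
    rw [ext_dom_tuples h.1 (h.2.antisymm h1)]
    exact ModSteps.refl D
  | succ n ih =>
    obtain ⟨t, ht⟩ : (D.tuples \ E.tuples).Nonempty := Finset.card_pos.1 (by omega)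
    obtain ⟨htD, htE⟩ := Finset.mem_sdiff.1 ht
    let D' : RelDB σ := ⟨D.dom, D.tuples.erase t,
      fun s hs => D.elems_subset s (Finset.mem_of_mem_erase hs)⟩
    refine ModSteps.step (E := D') (Modification.deleteTuple t htD rfl rfl) (ih ⟨h.1, ?_⟩ ?_)
    · exact fun s hs => Finset.mem_erase.2 ⟨fun he => htE (he ▸ hs), h.2 hs⟩
    · change (D.tuples.erase t \ E.tuples).card = n
      rw [Finset.erase_sdiff_comm, Finset.card_erase_of_mem ht, hn]
      rfl

theorem modSteps_induced (D : RelDB σ) {A : Finset ℕ} (hA : A ⊆ D.dom) :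
    ModSteps (D.dom \ A).card D (D.induced A) := by
  classical
  generalize hn : (D.dom \ A).card = n
  induction n generalizing D with
  | zero =>
    have h1 : D.dom ⊆ A := Finset.sdiff_eq_empty_iff_subset.1 (Finset.card_eq_zero.1 hn)
    have : D.induced A = D := ext_dom_tuples (Finset.inter_eq_left.2 h1)
      (Finset.filter_true_of_mem fun t ht => (D.elems_subset t ht).trans h1)
    rw [this]
    exact ModSteps.refl D
  | succ n ih =>
    obtain ⟨a, ha⟩ : (D.dom \ A).Nonempty := Finset.card_pos.1 (by omega)
    obtain ⟨haD, haA⟩ := Finset.mem_sdiff.1 ha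
    let D' : RelDB σ :=
      { dom := D.dom.erase a
        tuples := D.tuples.filter (fun t => a ∉ RelTuple.elems t)
        elems_subset := fun t ht => by
          rw [Finset.mem_filter] at ht
          exact Finset.subset_erase.2 ⟨D.elems_subset t ht.1, ht.2⟩ }
    have hAD' : A ⊆ D'.dom := Finset.subset_erase.2 ⟨hA, haA⟩
    have hind : D.induced A = D'.induced A := by
      refine ext_dom_tuples ?_ ?_
      · change D.dom ∩ A = D'.dom ∩ A
        rw [Finset.inter_eq_right.2 hA, Finset.inter_eq_right.2 hAD']
      · ext t
        rw [mem_tuples_induced, mem_tuples_induced]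
        simp only [D', Finset.mem_filter]
        exact ⟨fun h => ⟨⟨h.1, fun h' => haA (h.2 h')⟩, h.2⟩, fun h => ⟨h.1.1, h.2⟩⟩
    rw [hind]
    refine ModSteps.step (E := D') (Modification.deleteElem a haD rfl rfl) (ih D' hAD' ?_)
    change (D.dom.erase a \ A).card = n
    rw [Finset.erase_sdiff_comm, Finset.card_erase_of_mem ha, hn]
    rfl

/-- The distance of two databases is bounded by the number of tuples whose removal makes all
components small, plus the distance of the histograms that remain. -/
theorem distPM_le_of_small {d r : ℕ} (hr : 1 ≤ r) {D E F G : RelDB σ} (hDF : IsTupleRemoval D F)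
    (hEG : IsTupleRemoval E G) (hF : F.DegreeLE d) (hG : G.DegreeLE d)
    (hFc : ∀ a ∈ F.dom, (F.ball (r + 1) a).card ≤ r)
    (hGc : ∀ a ∈ G.dom, (G.ball (r + 1) a).card ≤ r) :
    (distPM D E : ℝ) ≤
      (D.tuples \ F.tuples).card + (E.tuples \ G.tuples).card + histDist d r F G := by
  obtain ⟨A, hA, B, hB, hiso, hle⟩ := exists_iso_induced_of_small hr hF hG hFc hGc
  have hmem : (D.tuples \ F.tuples).card + (F.dom \ A).card +
      ((E.tuples \ G.tuples).card + (G.dom \ B).card) ∈ modCounts D E :=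
    ⟨_, _, _, _, hDF.modSteps.trans (modSteps_induced F hA),
      hEG.modSteps.trans (modSteps_induced G hB), hiso, rfl⟩
  have h1 : (distPM D E : ℝ) ≤ ((D.tuples \ F.tuples).card + (F.dom \ A).card +
      ((E.tuples \ G.tuples).card + (G.dom \ B).card) : ℕ) := by
    exact_mod_cast Nat.sInf_le hmem
  push_cast at h1 hle
  linarith

theorem DegreeLE.of_isTupleRemoval {d : ℕ} {D F : RelDB σ} (hD : D.DegreeLE d)
    (h : IsTupleRemoval D F) : F.DegreeLE d := fun a ha =>
  (Finset.card_le_card (Finset.filter_subset_filter _ h.2)).trans (hD a (h.1 ▸ ha))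

end RelDB

/-! ### Uniformly random subsets of a finite set -/

section RandomSubset

open Finset
open scoped BigOperators

variable {α ι : Type*} [DecidableEq α]

/-- A random subset of `I ∪ J` is the union of independent random subsets of `I` and `J`. -/
theorem expect_powerset_union {I J : Finset α} (h : Disjoint I J) (f : Finset α → ℝ) :
    𝔼 c ∈ (I ∪ J).powerset, f c = 𝔼 a ∈ I.powerset, 𝔼 b ∈ J.powerset, f (a ∪ b) := by
  rw [← expect_product']
  refine expect_nbij' (fun c => (c ∩ I, c ∩ J)) (fun p => p.1 ∪ p.2) ?_ ?_ ?_ ?_ ?_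
  · intro c _
    simp only [mem_product, mem_powerset]
    exact ⟨inter_subset_right, inter_subset_right⟩
  · intro p hp
    simp only [mem_product, mem_powerset] at hp ⊢
    exact union_subset_union hp.1 hp.2
  · intro c hc
    rw [mem_powerset] at hc
    rw [← inter_union_distrib_left, inter_eq_left.2 hc]
  · rintro ⟨a, b⟩ hp
    simp only [mem_product, mem_powerset] at hp
    have h1 : b ∩ I = ∅ := disjoint_iff_inter_eq_empty.1 (h.symm.mono_left hp.2)
    have h2 : a ∩ J = ∅ := disjoint_iff_inter_eq_empty.1 (h.mono_left hp.1)
    simp only [union_inter_distrib_right, h1, h2, inter_eq_left.2 hp.1, inter_eq_left.2 hp.2,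
      union_empty, empty_union]
  · intro c hc
    rw [mem_powerset] at hc
    rw [← inter_union_distrib_left, inter_eq_left.2 hc]

theorem expect_powerset_inter {I J : Finset α} (h : J ⊆ I) (f : Finset α → ℝ) :
    𝔼 c ∈ I.powerset, f (c ∩ J) = 𝔼 c ∈ J.powerset, f c := by
  rw [← union_sdiff_of_subset h, expect_powerset_union disjoint_sdiff]
  refine expect_congr rfl fun a ha => ?_
  rw [mem_powerset] at ha
  rw [expect_congr rfl (g := fun _ => f a), expect_const (powerset_nonempty _)]
  intro b hb
  rw [mem_powerset] at hb
  have h2 : b ∩ J = ∅ := disjoint_iff_inter_eq_empty.1 (sdiff_disjoint.mono_left hb)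
  rw [union_inter_distrib_right, h2, inter_eq_left.2 ha, union_empty]

/-- Functions of the traces on disjoint sets are independent. -/
theorem expect_powerset_mul {I A B : Finset α} (hA : A ⊆ I) (hB : B ⊆ I) (hAB : Disjoint A B)
    {f g : Finset α → ℝ} (hf : ∀ c ⊆ I, f c = f (c ∩ A)) (hg : ∀ c ⊆ I, g c = g (c ∩ B)) :
    𝔼 c ∈ I.powerset, f c * g c = (𝔼 c ∈ I.powerset, f c) * 𝔼 c ∈ I.powerset, g c := by
  have hl : ∀ {h : Finset α → ℝ} {C : Finset α}, C ⊆ I → (∀ c ⊆ I, h c = h (c ∩ C)) →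
      𝔼 c ∈ I.powerset, h c = 𝔼 c ∈ C.powerset, h c := fun {h C} hC hh => by
    rw [← expect_powerset_inter hC]
    exact expect_congr rfl fun c hc => hh c (mem_powerset.1 hc)
  have hfg : ∀ c ⊆ I, f c * g c = f (c ∩ (A ∪ B)) * g (c ∩ (A ∪ B)) := by
    intro c hc
    rw [hf c hc, hg c hc, hf (c ∩ (A ∪ B)) (inter_subset_left.trans hc),
      hg (c ∩ (A ∪ B)) (inter_subset_left.trans hc), inter_assoc, inter_assoc,
      inter_eq_right.2 subset_union_left, inter_eq_right.2 subset_union_right]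
  rw [hl hA hf, hl hB hg, hl (h := fun c => f c * g c) (union_subset hA hB) hfg,
    expect_powerset_union hAB, expect_mul_expect]
  refine expect_congr rfl fun a ha => expect_congr rfl fun b hb => ?_
  rw [mem_powerset] at ha hb
  have h1 : a ∪ b ⊆ I := union_subset (ha.trans hA) (hb.trans hB)
  rw [hf _ h1, hg _ h1, union_inter_distrib_right, union_inter_distrib_right,
    disjoint_iff_inter_eq_empty.1 (hAB.symm.mono_left hb),
    disjoint_iff_inter_eq_empty.1 (hAB.mono_left ha),
    inter_eq_left.2 ha, inter_eq_left.2 hb, union_empty, empty_union]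

/-- A random set has a prescribed trace on `J` with probability `2 ^ (-|J|)`. -/
theorem expect_powerset_pattern {I J p : Finset α} (h : J ⊆ I) (hp : p ⊆ J) :
    𝔼 c ∈ I.powerset, (if c ∩ J = p then (1 : ℝ) else 0) = (1 / 2) ^ J.card := by
  rw [expect_powerset_inter h (fun c => if c = p then (1 : ℝ) else 0),
    expect_eq_sum_div_card, card_powerset, sum_ite_eq' _ p, if_pos (mem_powerset.2 hp)]
  simp

/-- A sum of random variables with values in `[0, 1]`, each of which is determined by a small part
of the random set, has small variance. -/
theorem expect_powerset_variance_le {I : Finset α} (V : Finset ι) (A : ι → Finset α)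
    (hA : ∀ a ∈ V, A a ⊆ I) (X : ι → Finset α → ℝ) (h0 : ∀ a c, 0 ≤ X a c) (h1 : ∀ a c, X a c ≤ 1)
    (hX : ∀ a ∈ V, ∀ c ⊆ I, X a c = X a (c ∩ A a)) (B : ℕ)
    (hB : ∀ a ∈ V, (V.filter (fun b => ¬ Disjoint (A a) (A b))).card ≤ B) :
    𝔼 c ∈ I.powerset, (∑ a ∈ V, X a c - 𝔼 c ∈ I.powerset, ∑ a ∈ V, X a c) ^ 2 ≤ V.card * B := by
  have hne : I.powerset.Nonempty := powerset_nonempty _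
  set m : ι → ℝ := fun a => 𝔼 c ∈ I.powerset, X a c with hm
  have hm0 : ∀ a, 0 ≤ m a := fun a => expect_nonneg fun c _ => h0 a c
  have hm1 : ∀ a, m a ≤ 1 := fun a => expect_le hne fun c _ => h1 a c
  have hsq : ∀ c, (∑ a ∈ V, X a c - 𝔼 c ∈ I.powerset, ∑ a ∈ V, X a c) ^ 2 =
      ∑ a ∈ V, ∑ b ∈ V, (X a c - m a) * (X b c - m b) := by
    intro c
    rw [expect_sum_comm, ← sum_sub_distrib, sq, sum_mul_sum]
  simp only [hsq]
  rw [expect_sum_comm, ← nsmul_eq_mul]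
  refine sum_le_card_nsmul _ _ _ fun a ha => ?_
  rw [expect_sum_comm]
  have hcov : ∀ b ∈ V, 𝔼 c ∈ I.powerset, (X a c - m a) * (X b c - m b) ≤
      if ¬ Disjoint (A a) (A b) then (1 : ℝ) else 0 := by
    intro b hb
    split_ifs with hd
    · rw [expect_powerset_mul (hA a ha) (hA b hb) hd (f := fun c => X a c - m a)
        (g := fun c => X b c - m b) (fun c hc => by rw [hX a ha c hc])
        (fun c hc => by rw [hX b hb c hc]), expect_sub_distrib, expect_const hne]
      simp [hm]
    · refine expect_le hne fun c _ => ?_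
      have e1 : |X a c - m a| ≤ 1 := by
        rw [abs_le]
        constructor <;> linarith [h0 a c, h1 a c, hm0 a, hm1 a]
      have e2 : |X b c - m b| ≤ 1 := by
        rw [abs_le]
        constructor <;> linarith [h0 b c, h1 b c, hm0 b, hm1 b]
      refine (le_abs_self _).trans ?_
      rw [abs_mul]
      exact mul_le_one₀ e1 (abs_nonneg _) e2
  refine (sum_le_sum hcov).trans ?_
  rw [sum_boole]
  exact_mod_cast hB a ha

end RandomSubset

namespace RelDB

open RelTuple

variable {σ : RelSchema}

/-! ### The random partition -/

/-- The tuples inside `U` that meet `S` without being contained in it. -/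
def cutTuples (D : RelDB σ) (U S : Finset ℕ) : Finset (RelTuple σ) :=
  D.tuples.filter (fun t => RelTuple.elems t ⊆ U ∧ (∃ x ∈ RelTuple.elems t, x ∈ S) ∧
    ¬ RelTuple.elems t ⊆ S)

/-- `S` is a set of at most `k` active elements, connected by the tuples inside `S`, such that no
tuple of `D[U]` joins `S` to an active element outside `S`, and at most `|S| / q` tuples of `D[U]`
have to be removed to separate `S` from the rest of `U`. Here `W` is the set of active elements.
Connectedness is expressed by tuples crossing every nontrivial bipartition; the empty set is
allowed. -/
structure IsCell (D : RelDB σ) (k q : ℕ) (U : Finset ℕ) (W : Set ℕ) (S : Finset ℕ) : Prop where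
  subset : S ⊆ U
  active : ∀ x ∈ S, x ∈ W
  card_le : S.card ≤ k
  conn : ∀ X ⊆ S, X.Nonempty → X ≠ S → ∃ t ∈ D.tuples, RelTuple.elems t ⊆ S ∧
    (∃ x ∈ RelTuple.elems t, x ∈ X) ∧ ∃ y ∈ RelTuple.elems t, y ∉ X
  isolated : ∀ t ∈ D.tuples, RelTuple.elems t ⊆ U → (∃ x ∈ RelTuple.elems t, x ∈ S) →
    ∀ y ∈ RelTuple.elems t, y ∈ W → y ∈ S
  cut_le : q * (D.cutTuples U S).card ≤ S.card

open Classical in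
/-- The elements that are left after `i` rounds of the partitioning procedure. In round `i` the
active elements are those `x` with `(i, x) ∈ c`, and all elements of cells are removed. -/
noncomputable def alive (D : RelDB σ) (k q : ℕ) (c : Finset (ℕ × ℕ)) : ℕ → Finset ℕ
  | 0 => D.dom
  | i + 1 => (alive D k q c i).filter
      (fun b => ¬ ∃ S, b ∈ S ∧ D.IsCell k q (alive D k q c i) {x | (i, x) ∈ c} S)

/-- `S` is one of the cells removed in round `i`. -/
def InRound (D : RelDB σ) (k q : ℕ) (c : Finset (ℕ × ℕ)) (i : ℕ) (S : Finset ℕ) : Prop :=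
  D.IsCell k q (D.alive k q c i) {x | (i, x) ∈ c} S

open Classical in
/-- The database in which only the tuples inside the cells of the first `T` rounds are kept. -/
noncomputable def cellDB (D : RelDB σ) (k q T : ℕ) (c : Finset (ℕ × ℕ)) : RelDB σ where
  dom := D.dom
  tuples := D.tuples.filter
    (fun t => ∃ i < T, ∃ S, D.InRound k q c i S ∧ RelTuple.elems t ⊆ S)
  elems_subset := fun t ht => D.elems_subset t (Finset.mem_filter.1 ht).1

theorem IsCell.eq_of_mem {D : RelDB σ} {k q : ℕ} {U : Finset ℕ} {W : Set ℕ} {S S' : Finset ℕ}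
    (h : D.IsCell k q U W S) (h' : D.IsCell k q U W S') {x : ℕ} (hx : x ∈ S) (hx' : x ∈ S') :
    S = S' := by
  have key : ∀ {S S' : Finset ℕ}, D.IsCell k q U W S → D.IsCell k q U W S' → x ∈ S → x ∈ S' →
      S' ⊆ S := by
    intro S S' h h' hx hx'
    by_contra hsub
    obtain ⟨t, ht, htS, ⟨y, hy, hyX⟩, z, hz, hzX⟩ := h'.conn (S' ∩ S) Finset.inter_subset_left
      ⟨x, Finset.mem_inter.2 ⟨hx', hx⟩⟩ (fun he => hsub (Finset.inter_eq_left.1 he))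
    exact hzX (Finset.mem_inter.2 ⟨htS hz, h.isolated t ht (htS.trans h'.subset)
      ⟨y, hy, (Finset.mem_inter.1 hyX).2⟩ z hz (h'.active z (htS hz))⟩)
  exact (key h' h hx' hx).antisymm (key h h' hx hx')

theorem IsCell.subset_ball {D : RelDB σ} {k q : ℕ} {U : Finset ℕ} {W : Set ℕ} {S : Finset ℕ}
    (h : D.IsCell k q U W S) {a : ℕ} (haD : a ∈ D.dom) (ha : a ∈ S) : S ⊆ D.ball k a := by
  have key : ∀ j, S ⊆ D.ball j a ∨ j + 1 ≤ (S ∩ D.ball j a).card := by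
    intro j
    induction j with
    | zero =>
      right
      rw [zero_add, Nat.succ_le_iff, Finset.card_pos]
      exact ⟨a, Finset.mem_inter.2 ⟨ha, mem_ball_self 0 haD⟩⟩
    | succ j ih =>
      by_cases hs : S ⊆ D.ball j a
      · exact Or.inl (hs.trans (D.ball_mono (Nat.le_succ j) a))
      · right
        obtain ⟨t, ht, htS, ⟨x, hx, hxX⟩, y, hy, hyX⟩ := h.conn (S ∩ D.ball j a)
          Finset.inter_subset_left ⟨a, Finset.mem_inter.2 ⟨ha, mem_ball_self j haD⟩⟩
          (fun he => hs (Finset.inter_eq_left.1 he))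
        have hlt : S ∩ D.ball j a ⊂ S ∩ D.ball (j + 1) a := by
          refine Finset.ssubset_iff_of_subset
            (Finset.inter_subset_inter_left (D.ball_mono (Nat.le_succ j) a)) |>.2 ⟨y, ?_, hyX⟩
          exact Finset.mem_inter.2
            ⟨htS hy, elems_subset_ball_succ ht (Finset.mem_inter.1 hxX).2 hx hy⟩
        have h1 := Finset.card_lt_card hlt
        have h2 := ih.resolve_left hs
        omega
  rcases key k with h1 | h1
  · exact h1
  · have h2 := Finset.card_le_card (Finset.inter_subset_left (s₁ := S) (s₂ := D.ball k a))
    have h3 := h.card_le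
    omega

section Procedure

variable {D : RelDB σ} {k q T : ℕ} {c : Finset (ℕ × ℕ)}

theorem mem_alive_succ {i b : ℕ} :
    b ∈ D.alive k q c (i + 1) ↔ b ∈ D.alive k q c i ∧ ¬ ∃ S, b ∈ S ∧ D.InRound k q c i S := by
  simp only [alive, Finset.mem_filter, InRound]

theorem alive_antitone : Antitone (D.alive k q c) :=
  antitone_nat_of_succ_le fun _ _ hb => (mem_alive_succ.1 hb).1

theorem alive_subset_dom (i : ℕ) : D.alive k q c i ⊆ D.dom := alive_antitone (Nat.zero_le i)

theorem mem_tuples_cellDB {t : RelTuple σ} : t ∈ (D.cellDB k q T c).tuples ↔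
    t ∈ D.tuples ∧ ∃ i < T, ∃ S, D.InRound k q c i S ∧ RelTuple.elems t ⊆ S := by
  simp only [cellDB, Finset.mem_filter]

theorem isTupleRemoval_cellDB : IsTupleRemoval D (D.cellDB k q T c) :=
  ⟨rfl, fun _ ht => (mem_tuples_cellDB.1 ht).1⟩

theorem InRound.eq_of_mem {i j x : ℕ} {S S' : Finset ℕ} (h : D.InRound k q c i S)
    (h' : D.InRound k q c j S') (hx : x ∈ S) (hx' : x ∈ S') : S = S' := by
  have hij : ∀ {i j : ℕ} {S S' : Finset ℕ}, D.InRound k q c i S → D.InRound k q c j S' →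
      x ∈ S → x ∈ S' → j ≤ i := by
    intro i j S S' h h' hx hx'
    by_contra! hlt
    exact (mem_alive_succ.1 (alive_antitone (Nat.succ_le_iff.2 hlt) (h'.subset hx'))).2 ⟨S, hx, h⟩
  obtain rfl : i = j := (hij h' h hx' hx).antisymm (hij h h' hx hx')
  exact IsCell.eq_of_mem h h' hx hx'

/-- The components of `cellDB` lie inside cells, or are single elements. -/
theorem card_ball_cellDB_le (hk : 1 ≤ k) {a : ℕ} (ha : a ∈ D.dom) (j : ℕ) :
    ((D.cellDB k q T c).ball j a).card ≤ k := by
  by_cases h : ∃ i < T, ∃ S, D.InRound k q c i S ∧ a ∈ S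
  · obtain ⟨i, hi, S, hS, haS⟩ := h
    refine (Finset.card_le_card ?_).trans hS.card_le
    induction j with
    | zero => rw [ball_zero (D := D.cellDB k q T c) ha]; simpa using haS
    | succ j ih =>
      intro b hb
      rcases mem_ball_succ.1 hb with hb | ⟨x, hx, -, t, ht, hxt, hbt⟩
      · exact ih hb
      · obtain ⟨-, i', -, S', hS', htS'⟩ := mem_tuples_cellDB.1 ht
        rw [hS.eq_of_mem hS' (ih hx) (htS' hxt)]
        exact htS' hbt
  · refine (Finset.card_le_card (t := {a}) ?_).trans (by simpa using hk)
    induction j with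
    | zero => rw [ball_zero (D := D.cellDB k q T c) ha]
    | succ j ih =>
      intro b hb
      rcases mem_ball_succ.1 hb with hb | ⟨x, hx, -, t, ht, hxt, hbt⟩
      · exact ih hb
      · obtain ⟨-, i', hi', S', hS', htS'⟩ := mem_tuples_cellDB.1 ht
        rw [Finset.mem_singleton.1 (ih hx)] at hxt
        exact absurd ⟨i', hi', S', hS', htS' hxt⟩ h

/-- Each removed tuple is charged either to the first cell it meets or to an element that is left
at the end. -/
theorem card_removed_le {d : ℕ} (hD : D.DegreeLE d) :
    q * (D.tuples \ (D.cellDB k q T c).tuples).card ≤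
      D.dom.card + q * (d * (D.alive k q c T).card) := by
  classical
  -- The tuples broken up before round `i`; each is charged to a cell that it crosses.
  let bad : ℕ → Finset (RelTuple σ) := fun i => D.tuples.filter (fun t =>
    (¬ ∃ j < i, ∃ S, D.InRound k q c j S ∧ RelTuple.elems t ⊆ S) ∧
      ¬ RelTuple.elems t ⊆ D.alive k q c i)
  have hbad : ∀ i, q * (bad i).card + (D.alive k q c i).card ≤ D.dom.card := by
    intro i
    induction i with
    | zero =>
      have h0 : bad 0 = ∅ := Finset.filter_eq_empty_iff.2 fun t ht h => h.2 (D.elems_subset t ht)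
      rw [h0]
      simp [alive]
    | succ i ih =>
      let cells : Finset (Finset ℕ) :=
        (D.alive k q c i).powerset.filter (D.InRound k q c i)
      have hcells : ∀ {S}, S ∈ cells ↔ D.InRound k q c i S := fun {S} =>
        ⟨fun h => (Finset.mem_filter.1 h).2, fun h => Finset.mem_filter.2
          ⟨Finset.mem_powerset.2 h.subset, h⟩⟩
      have hsub : bad (i + 1) ⊆ bad i ∪ cells.biUnion (D.cutTuples (D.alive k q c i)) := by
        intro t ht
        obtain ⟨htD, ht1, ht2⟩ := Finset.mem_filter.1 ht
        rw [Finset.mem_union]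
        by_cases htU : RelTuple.elems t ⊆ D.alive k q c i
        · right
          obtain ⟨x, hx, hxa⟩ := Finset.not_subset.1 ht2
          obtain ⟨S, hxS, hS⟩ : ∃ S, x ∈ S ∧ D.InRound k q c i S := by
            by_contra h
            exact hxa (mem_alive_succ.2 ⟨htU hx, h⟩)
          refine Finset.mem_biUnion.2 ⟨S, hcells.2 hS, Finset.mem_filter.2
            ⟨htD, htU, ⟨x, hx, hxS⟩, fun hts => ht1 ⟨i, Nat.lt_succ_self i, S, hS, hts⟩⟩⟩
        · left
          exact Finset.mem_filter.2
            ⟨htD, fun ⟨j, hj, h⟩ => ht1 ⟨j, hj.trans (Nat.lt_succ_self i), h⟩, htU⟩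
      have hunion : cells.biUnion id = D.alive k q c i \ D.alive k q c (i + 1) := by
        ext x
        rw [Finset.mem_biUnion, Finset.mem_sdiff, mem_alive_succ]
        constructor
        · rintro ⟨S, hS, hx⟩
          exact ⟨(hcells.1 hS).subset hx, fun h => h.2 ⟨S, hx, hcells.1 hS⟩⟩
        · rintro ⟨hx, h⟩
          by_contra hn
          exact h ⟨hx, fun ⟨S, hxS, hS⟩ => hn ⟨S, hcells.2 hS, hxS⟩⟩
      have hsum : ∑ S ∈ cells, S.card = (cells.biUnion id).card := by
        rw [Finset.card_biUnion]
        · rfl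
        · intro S hS S' hS' hne
          refine Finset.disjoint_left.2 fun x hx hx' => hne ?_
          exact (hcells.1 hS).eq_of_mem (hcells.1 hS') hx hx'
      have h1 := Finset.card_le_card hsub
      have h2 := Finset.card_union_le (bad i) (cells.biUnion (D.cutTuples (D.alive k q c i)))
      have h3 : (cells.biUnion (D.cutTuples (D.alive k q c i))).card ≤ _ :=
        Finset.card_biUnion_le
      have h4 : q * ∑ S ∈ cells, (D.cutTuples (D.alive k q c i) S).card ≤ ∑ S ∈ cells, S.card := by
        rw [Finset.mul_sum]
        exact Finset.sum_le_sum fun S hS => (hcells.1 hS).cut_le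
      rw [hsum, hunion, Finset.card_sdiff_of_subset (alive_antitone (Nat.le_succ i))] at h4
      have h5 := Finset.card_le_card (alive_antitone (D := D) (k := k) (q := q) (c := c)
        (Nat.le_succ i))
      have h6 := Nat.mul_le_mul_left q (h1.trans (h2.trans (Nat.add_le_add_left h3 _)))
      rw [Nat.mul_add] at h6
      simp only [Nat.succ_eq_add_one] at h5 h4
      omega
  have hsub : D.tuples \ (D.cellDB k q T c).tuples ⊆ bad T ∪
      (D.alive k q c T).biUnion (fun x => D.tuples.filter (fun t => x ∈ RelTuple.elems t)) := by
    intro t ht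
    obtain ⟨htD, htn⟩ := Finset.mem_sdiff.1 ht
    rw [mem_tuples_cellDB, not_and] at htn
    rw [Finset.mem_union]
    by_cases htU : RelTuple.elems t ⊆ D.alive k q c T
    · right
      obtain ⟨x, hx⟩ := elems_nonempty t
      exact Finset.mem_biUnion.2 ⟨x, htU hx, Finset.mem_filter.2 ⟨htD, hx⟩⟩
    · left
      exact Finset.mem_filter.2 ⟨htD, htn htD, htU⟩
  have h1 := (Finset.card_le_card hsub).trans (Finset.card_union_le _ _)
  have h2 := Finset.card_biUnion_le_card_mul (D.alive k q c T)
    (fun x => D.tuples.filter (fun t => x ∈ RelTuple.elems t)) d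
    (fun x hx => hD x (alive_subset_dom T hx))
  rw [mul_comm] at h2
  have h3 := Nat.mul_le_mul_left q (h1.trans (Nat.add_le_add_left h2 _))
  rw [Nat.mul_add] at h3
  have h4 := hbad T
  omega

/-! ### Locality of the random partition -/

variable {E : RelDB σ} {c' : Finset (ℕ × ℕ)}

/-- A local isomorphism with enough room maps cells to cells, provided it respects the elements
alive. -/
theorem IsCell.image {U U' S : Finset ℕ} {W W' : Set ℕ} {a : ℕ} {φ : ℕ → ℕ}
    (hS : D.IsCell k q U W S) (haD : a ∈ D.dom) (ha : a ∈ S) (hl : LocalIso D E (k + 1) a φ)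
    (hU : ∀ x ∈ D.ball (k + 1) a, x ∈ U ↔ φ x ∈ U')
    (hW : ∀ x ∈ D.ball (k + 1) a, x ∈ W ↔ φ x ∈ W') : E.IsCell k q U' W' (S.image φ) := by
  classical
  have hSk : S ⊆ D.ball k a := hS.subset_ball haD ha
  have hSb : S ⊆ D.ball (k + 1) a := hSk.trans (D.ball_mono (Nat.le_succ k) a)
  -- Every tuple of `E` that meets the image of `S` comes from a tuple of `D` that meets `S`.
  have hlift : ∀ t' ∈ E.tuples, (∃ x ∈ RelTuple.elems t', x ∈ S.image φ) →
      ∃ t ∈ D.tuples, RelTuple.elems t ⊆ D.ball (k + 1) a ∧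
        (∃ x ∈ RelTuple.elems t, x ∈ S) ∧ relabel φ t = t' := by
    rintro t' ht' ⟨x', hx', hxS'⟩
    obtain ⟨x, hxS, rfl⟩ := Finset.mem_image.1 hxS'
    have hx2 : φ x ∈ E.ball k (φ a) := by
      rw [← hl.image_ball haD (Nat.le_succ k)]
      exact Finset.mem_image_of_mem φ (hSk hxS)
    obtain ⟨t, ht, hts, rfl⟩ := hl.exists_relabel_eq ht' (elems_subset_ball_succ ht' hx2 hx')
    rw [elems_relabel] at hx'
    obtain ⟨z, hz, hzx⟩ := Finset.mem_image.1 hx'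
    exact ⟨t, ht, hts, ⟨z, hz, hl.inj (hts hz) (hSb hxS) hzx ▸ hxS⟩, rfl⟩
  refine ⟨?_, ?_, Finset.card_image_le.trans hS.card_le, ?_, ?_, ?_⟩
  · intro y hy
    obtain ⟨x, hx, rfl⟩ := Finset.mem_image.1 hy
    exact (hU x (hSb hx)).1 (hS.subset hx)
  · intro y hy
    obtain ⟨x, hx, rfl⟩ := Finset.mem_image.1 hy
    exact (hW x (hSb hx)).1 (hS.active x hx)
  · intro X' hX' hne hneq
    let X := S.filter (fun x => φ x ∈ X')
    have hmem : ∀ x ∈ S, x ∈ X ↔ φ x ∈ X' := fun x hx => by simp [X, hx]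
    obtain ⟨t, ht, hts, ⟨x, hx, hxX⟩, y, hy, hyX⟩ := hS.conn X (Finset.filter_subset _ _)
      (by
        obtain ⟨y, hy⟩ := hne
        obtain ⟨x, hx, rfl⟩ := Finset.mem_image.1 (hX' hy)
        exact ⟨x, (hmem x hx).2 hy⟩)
      (fun he => hneq (hX'.antisymm fun y hy => by
        obtain ⟨x, hx, rfl⟩ := Finset.mem_image.1 hy
        exact (hmem x hx).1 (he.symm ▸ hx)))
    refine ⟨relabel φ t, (hl.mem_iff t (hts.trans hSb)).1 ht, ?_, ⟨φ x, ?_, ?_⟩, φ y, ?_, ?_⟩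
    · rw [elems_relabel]; exact Finset.image_subset_image hts
    · rw [elems_relabel]; exact Finset.mem_image_of_mem φ hx
    · exact (hmem x (hts hx)).1 hxX
    · rw [elems_relabel]; exact Finset.mem_image_of_mem φ hy
    · exact fun h => hyX ((hmem y (hts hy)).2 h)
  · intro t' ht' htU' hmeet y' hy' hyW'
    obtain ⟨t, ht, hts, htS, rfl⟩ := hlift t' ht' hmeet
    rw [elems_relabel] at htU' hy'
    obtain ⟨y, hy, rfl⟩ := Finset.mem_image.1 hy'
    refine Finset.mem_image_of_mem φ (hS.isolated t ht (fun z hz => ?_) htS y hy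
      ((hW y (hts hy)).2 hyW'))
    exact (hU z (hts hz)).2 (htU' (Finset.mem_image_of_mem φ hz))
  · have hsub : E.cutTuples U' (S.image φ) ⊆ (D.cutTuples U S).image (relabel φ) := by
      intro t' ht'
      obtain ⟨htE, htU', hmeet, hnot⟩ := Finset.mem_filter.1 ht'
      obtain ⟨t, ht, hts, htS, rfl⟩ := hlift t' htE hmeet
      rw [elems_relabel] at htU' hnot
      refine Finset.mem_image_of_mem _ (Finset.mem_filter.2 ⟨ht, fun z hz => ?_, htS, fun h => ?_⟩)
      · exact (hU z (hts hz)).2 (htU' (Finset.mem_image_of_mem φ hz))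
      · exact hnot (Finset.image_subset_image h)
    rw [Finset.card_image_of_injOn (hl.inj.mono (by exact_mod_cast hSb))]
    exact (Nat.mul_le_mul_left q ((Finset.card_le_card hsub).trans Finset.card_image_le)).trans
      hS.cut_le

/-- Whether `a` is alive after `i` rounds depends only on the coloured `i * (k + 1)`-neighbourhood
of `a`. -/
theorem mem_alive_iff_of_localIso (i : ℕ) : ∀ {D E : RelDB σ} {c c' : Finset (ℕ × ℕ)} {a : ℕ}
    {φ : ℕ → ℕ}, a ∈ D.dom → LocalIso D E (i * (k + 1)) a φ →
    (∀ x ∈ D.ball (i * (k + 1)) a, ∀ j, (j, x) ∈ c ↔ (j, φ x) ∈ c') →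
    (a ∈ D.alive k q c i ↔ φ a ∈ E.alive k q c' i) := by
  induction i with
  | zero =>
    intro D E c c' a φ ha hl _
    exact ⟨fun _ => hl.mem_dom ha, fun _ => ha⟩
  | succ i ih =>
    have hcell : ∀ {D E : RelDB σ} {c c' : Finset (ℕ × ℕ)} {a : ℕ} {φ : ℕ → ℕ}, a ∈ D.dom →
        LocalIso D E ((i + 1) * (k + 1)) a φ →
        (∀ x ∈ D.ball ((i + 1) * (k + 1)) a, ∀ j, (j, x) ∈ c ↔ (j, φ x) ∈ c') →
        (∃ S, a ∈ S ∧ D.InRound k q c i S) → ∃ S, φ a ∈ S ∧ E.InRound k q c' i S := by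
      rintro D E c c' a φ ha hl hc ⟨S, haS, hS⟩
      have hR : i * (k + 1) + (k + 1) ≤ (i + 1) * (k + 1) := by rw [Nat.succ_mul]
      have hk : k + 1 ≤ (i + 1) * (k + 1) := by nlinarith
      refine ⟨S.image φ, Finset.mem_image_of_mem φ haS, IsCell.image hS ha haS (hl.mono ha hk)
        (fun x hx => ih (D.ball_subset_dom _ _ hx) (hl.restrict ha hR hx) fun y hy j => ?_)
        (fun x hx => hc x (D.ball_mono hk a hx) i)⟩
      exact hc y (D.ball_mono hR a (mem_ball_trans hx hy)) j
    intro D E c c' a φ ha hl hc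
    have hle : i * (k + 1) ≤ (i + 1) * (k + 1) := Nat.mul_le_mul_right _ (Nat.le_succ i)
    rw [mem_alive_succ, mem_alive_succ]
    refine and_congr (ih ha (hl.mono ha hle) fun x hx => hc x (D.ball_mono hle a hx))
      (not_congr ⟨hcell ha hl hc, fun h => ?_⟩)
    obtain ⟨ψ, hψ, hinv⟩ := hl.symm ha
    have h' := hcell (c' := c) (hl.mem_dom ha) hψ (fun y hy j => ?_) h
    · rwa [hinv a (mem_ball_self _ ha)] at h'
    · rw [← hl.image] at hy
      obtain ⟨x, hx, rfl⟩ := Finset.mem_image.1 hy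
      rw [hinv x hx, hc x hx j]

theorem ball_cellDB_subset (j a : ℕ) : (D.cellDB k q T c).ball j a ⊆ D.ball j a := by
  have hle : (D.cellDB k q T c).gaifman ≤ D.gaifman := by
    rintro x y ⟨hxy, t, ht, h⟩
    exact ⟨hxy, t, (mem_tuples_cellDB.1 ht).1, h⟩
  intro b hb
  obtain ⟨h1, h2⟩ := mem_ball.1 hb
  exact mem_ball.2 ⟨h1, (SimpleGraph.edist_anti hle).trans h2⟩

theorem relabel_mem_cellDB {a : ℕ} {φ : ℕ → ℕ} {r : ℕ} (ha : a ∈ D.dom)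
    (hl : LocalIso D E (T * (k + 1) + (r + 1)) a φ)
    (hc : ∀ x ∈ D.ball (T * (k + 1) + (r + 1)) a, ∀ j, (j, x) ∈ c ↔ (j, φ x) ∈ c')
    {t : RelTuple σ} (hts : RelTuple.elems t ⊆ D.ball (r + 1) a)
    (ht : t ∈ (D.cellDB k q T c).tuples) : relabel φ t ∈ (E.cellDB k q T c').tuples := by
  obtain ⟨htD, i, hi, S, hS, htS⟩ := mem_tuples_cellDB.1 ht
  refine mem_tuples_cellDB.2 ⟨(hl.mem_iff t (hts.trans (D.ball_mono (by omega) a))).1 htD, i, hi,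
    S.image φ, ?_, by rw [elems_relabel]; exact Finset.image_subset_image htS⟩
  obtain ⟨x, hx⟩ := elems_nonempty t
  have hxb := hts hx
  have hxD := D.ball_subset_dom _ _ hxb
  have hlx : LocalIso D E (T * (k + 1)) x φ := hl.restrict ha le_rfl hxb
  have hcx : ∀ y ∈ D.ball (T * (k + 1)) x, ∀ j, (j, y) ∈ c ↔ (j, φ y) ∈ c' := fun y hy =>
    hc y (mem_ball_trans hxb hy)
  have hR : i * (k + 1) + (k + 1) ≤ T * (k + 1) := by
    rw [← Nat.succ_mul]; exact Nat.mul_le_mul_right _ hi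
  have hk : k + 1 ≤ T * (k + 1) := le_trans (Nat.le_add_left _ _) hR
  refine IsCell.image hS hxD (htS hx) (hlx.mono hxD hk)
    (fun y hy => mem_alive_iff_of_localIso i (D.ball_subset_dom _ _ hy)
      (hlx.restrict hxD hR hy) fun z hz j => ?_)
    (fun y hy => hcx y (D.ball_mono hk x hy) i)
  exact hcx z (D.ball_mono hR x (mem_ball_trans hy hz)) j

/-- The `r`-neighbourhood of `a` in `cellDB` depends only on the coloured neighbourhood of `a` of
radius `T * (k + 1) + (r + 1)`. -/
theorem LocalIso.cellDB {a : ℕ} {φ : ℕ → ℕ} {r : ℕ} (ha : a ∈ D.dom)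
    (hl : LocalIso D E (T * (k + 1) + (r + 1)) a φ)
    (hc : ∀ x ∈ D.ball (T * (k + 1) + (r + 1)) a, ∀ j, (j, x) ∈ c ↔ (j, φ x) ∈ c') :
    LocalIso (D.cellDB k q T c) (E.cellDB k q T c') r a φ := by
  obtain ⟨ψ, hψ, hinv⟩ := hl.symm ha
  have hmono : ∀ j ≤ r + 1, D.ball j a ⊆ D.ball (T * (k + 1) + (r + 1)) a := fun j hj =>
    D.ball_mono (by omega) a
  have hiff : ∀ t : RelTuple σ, RelTuple.elems t ⊆ D.ball (r + 1) a →
      (t ∈ (D.cellDB k q T c).tuples ↔ relabel φ t ∈ (E.cellDB k q T c').tuples) := by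
    intro t hts
    refine ⟨relabel_mem_cellDB ha hl hc hts, fun h => ?_⟩
    have h' := relabel_mem_cellDB (c' := c) (hl.mem_dom ha) hψ (fun y hy j => ?_) (t := relabel φ t)
      ?_ h
    · rwa [relabel_relabel, relabel_eq_self fun x hx => hinv x (hmono _ le_rfl (hts hx))] at h'
    · rw [← hl.image] at hy
      obtain ⟨x, hx, rfl⟩ := Finset.mem_image.1 hy
      rw [hinv x hx, hc x hx j]
    · rw [elems_relabel, ← hl.image_ball ha (Nat.le_add_left _ _)]
      exact Finset.image_subset_image hts
  refine ⟨hl.inj.mono ?_, ?_, ?_⟩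
  · exact_mod_cast (ball_cellDB_subset r a).trans (hmono r (Nat.le_succ r))
  · refine image_ball_of_lift (D := D.cellDB k q T c) (E := E.cellDB k q T c') ha
      (hl.mem_dom ha) r ?_ ?_ r le_rfl
    · rintro j hj x hx y ⟨hxy, t, ht, hxt, hyt⟩
      have hts : RelTuple.elems t ⊆ D.ball (r + 1) a :=
        (elems_subset_ball_succ (mem_tuples_cellDB.1 ht).1 (ball_cellDB_subset j a hx) hxt).trans
          (D.ball_mono (by omega) a)
      refine ⟨fun he => hxy (hl.inj (hmono _ le_rfl (hts hxt)) (hmono _ le_rfl (hts hyt)) he),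
        _, (hiff t hts).1 ht, ?_, ?_⟩
      · rw [elems_relabel]; exact Finset.mem_image_of_mem φ hxt
      · rw [elems_relabel]; exact Finset.mem_image_of_mem φ hyt
    · rintro j hj x hx hx' y' ⟨hxy', t', ht', hxt', hyt'⟩
      have hts' : RelTuple.elems t' ⊆ E.ball (r + 1) (φ a) :=
        (elems_subset_ball_succ (mem_tuples_cellDB.1 ht').1
          (ball_cellDB_subset j _ hx') hxt').trans (E.ball_mono (by omega) _)
      obtain ⟨t, -, hts, rfl⟩ := (hl.mono ha (Nat.le_add_left _ _)).exists_relabel_eq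
        (mem_tuples_cellDB.1 ht').1 hts'
      rw [elems_relabel] at hxt' hyt'
      obtain ⟨z, hz, hzx⟩ := Finset.mem_image.1 hxt'
      obtain ⟨y, hy, rfl⟩ := Finset.mem_image.1 hyt'
      have hxD := hmono j (by omega) (ball_cellDB_subset j a hx)
      obtain rfl := hl.inj (hmono _ le_rfl (hts hz)) hxD hzx
      exact ⟨y, ⟨fun he => hxy' (congrArg φ he), t, (hiff t hts).2 ht', hz, hy⟩, rfl⟩
  · exact fun t ht => hiff t ((ht.trans (ball_cellDB_subset r a)).trans
      (D.ball_mono (Nat.le_succ r) a))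

end Procedure

open scoped BigOperators

/-! ### Expected number of elements left over -/

theorem mem_component {D : RelDB σ} {a b : ℕ} :
    b ∈ D.component a ↔ b ∈ D.dom ∧ D.gaifman.Reachable a b := by
  classical
  simp [component]

theorem component_eq_of_mem {D : RelDB σ} {a b : ℕ} (h : b ∈ D.component a) :
    D.component b = D.component a := by
  ext x
  rw [mem_component, mem_component]
  exact and_congr_right fun _ =>
    ⟨(mem_component.1 h).2.trans, (mem_component.1 h).2.symm.trans⟩

theorem ball_subset_component (D : RelDB σ) (r a : ℕ) : D.ball r a ⊆ D.component a := by
  intro b hb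
  obtain ⟨h1, h2⟩ := mem_ball.1 hb
  exact mem_component.2 ⟨h1, SimpleGraph.reachable_of_edist_ne_top
    (ne_top_of_le_ne_top (by simp) h2)⟩

theorem elems_subset_component {D : RelDB σ} {t : RelTuple σ} (ht : t ∈ D.tuples) {a x : ℕ}
    (hx : x ∈ RelTuple.elems t) (hxa : x ∈ D.component a) : RelTuple.elems t ⊆ D.component a := by
  rw [← component_eq_of_mem hxa]
  exact (elems_subset_ball_one ht hx).trans (D.ball_subset_component 1 x)

theorem dom_induced_of_subset {D : RelDB σ} {U : Finset ℕ} (hU : U ⊆ D.dom) :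
    (D.induced U).dom = U := Finset.inter_eq_right.2 hU

theorem component_induced_subset (E : RelDB σ) (U : Finset ℕ) (b : ℕ) :
    (E.induced U).component b ⊆ E.component b := by
  intro x hx
  have hle : (E.induced U).gaifman ≤ E.gaifman := by
    rintro x y ⟨hxy, t, ht, h⟩
    exact ⟨hxy, t, (mem_tuples_induced.1 ht).1, h⟩
  exact mem_component.2 ⟨(Finset.mem_inter.1 (mem_component.1 hx).1).1,
    (mem_component.1 hx).2.mono hle⟩

/-- If the active elements contain a component `S` of `E[U]` and none of the neighbours of `S`,
then `S` is a cell, unless it has a large boundary. -/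
theorem isCell_component {D E : RelDB σ} {k q b : ℕ} {U : Finset ℕ} {W : Set ℕ}
    (hDE : IsTupleRemoval D E) (hk : ∀ a ∈ E.dom, (E.component a).card ≤ k) (hU : U ⊆ D.dom)
    (hb : b ∈ U)
    (hcut : q * (D.cutTuples U ((E.induced U).component b)).card ≤
      ((E.induced U).component b).card)
    (hin : ∀ x ∈ (E.induced U).component b, x ∈ W)
    (hout : ∀ x ∈ (E.induced U).component b, ∀ y ∈ D.ball 1 x, y ∈ W →
      y ∈ (E.induced U).component b) :
    D.IsCell k q U W ((E.induced U).component b) := by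
  have hUE : U ⊆ E.dom := hDE.1 ▸ hU
  have hsub : (E.induced U).component b ⊆ U := fun x hx => by
    have := (mem_component.1 hx).1
    rwa [dom_induced_of_subset hUE] at this
  refine ⟨hsub, hin, ?_, ?_, ?_, hcut⟩
  · exact (Finset.card_le_card (component_induced_subset E U b)).trans (hk b (hUE hb))
  · rintro X hX ⟨x, hx⟩ hne
    obtain ⟨y, hy, hyX⟩ := Finset.exists_of_ssubset (hX.ssubset_of_ne hne)
    have hxy : (E.induced U).gaifman.Reachable x y :=
      (mem_component.1 (hX hx)).2.symm.trans (mem_component.1 hy).2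
    obtain ⟨p⟩ := hxy
    obtain ⟨e, -, hu, hv⟩ := p.exists_boundary_dart (X : Set ℕ) hx hyX
    obtain ⟨-, t, ht, hut, hvt⟩ := e.adj
    exact ⟨t, hDE.2 (mem_tuples_induced.1 ht).1, elems_subset_component ht hut (hX hu),
      ⟨e.fst, hut, hu⟩, e.snd, hvt, hv⟩
  · rintro t ht htU ⟨x, hxt, hx⟩ y hyt hy
    exact hout x hx y (elems_subset_ball_one ht hxt hyt) hy

/-- Few elements lie in components of `E[U]` with a large boundary in `D[U]`. -/
theorem card_large_boundary_le {D E : RelDB σ} {q : ℕ} {U : Finset ℕ}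
    (hDE : IsTupleRemoval D E) (hU : U ⊆ D.dom) :
    (U.filter (fun b => ¬ q * (D.cutTuples U ((E.induced U).component b)).card ≤
      ((E.induced U).component b).card)).card ≤
      q * (Finset.univ.sup σ.arity * (D.tuples \ E.tuples).card) := by
  classical
  have hUE : U ⊆ E.dom := hDE.1 ▸ hU
  have hself : ∀ b ∈ U, b ∈ (E.induced U).component b := fun b hb =>
    mem_component.2 ⟨by rwa [dom_induced_of_subset hUE], SimpleGraph.Reachable.refl _⟩
  let comps : Finset (Finset ℕ) := U.image (E.induced U).component
  let large : Finset (Finset ℕ) :=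
    comps.filter (fun S => ¬ q * (D.cutTuples U S).card ≤ S.card)
  have h1 : U.filter (fun b => ¬ q * (D.cutTuples U ((E.induced U).component b)).card ≤
      ((E.induced U).component b).card) ⊆ large.biUnion id := by
    intro b hb
    obtain ⟨hbU, hb⟩ := Finset.mem_filter.1 hb
    exact Finset.mem_biUnion.2 ⟨_, Finset.mem_filter.2
      ⟨Finset.mem_image_of_mem _ hbU, hb⟩, hself b hbU⟩
  have h2 : ∑ S ∈ large, S.card ≤ ∑ S ∈ comps, q * (D.cutTuples U S).card := by
    refine (Finset.sum_le_sum fun S hS => (not_le.1 (Finset.mem_filter.1 hS).2).le).trans ?_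
    exact Finset.sum_le_sum_of_subset (Finset.filter_subset _ _)
  -- A tuple that is kept in `E` crosses no component, any other one crosses at most as many as
  -- its arity.
  have h3 : ∑ S ∈ comps, (D.cutTuples U S).card ≤
      ∑ t ∈ D.tuples \ E.tuples, Finset.univ.sup σ.arity := by
    have h4 : ∀ S ∈ comps, D.cutTuples U S ⊆
        (D.tuples \ E.tuples).filter (fun t => ∃ x ∈ RelTuple.elems t, x ∈ S) := by
      intro S hS t ht
      obtain ⟨b, -, rfl⟩ := Finset.mem_image.1 hS
      obtain ⟨htD, htU, ⟨x, hx, hxS⟩, hnot⟩ := Finset.mem_filter.1 ht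
      refine Finset.mem_filter.2 ⟨Finset.mem_sdiff.2 ⟨htD, fun htE => hnot ?_⟩, x, hx, hxS⟩
      exact elems_subset_component (mem_tuples_induced.2 ⟨htE, htU⟩) hx hxS
    refine (Finset.sum_le_sum fun S hS => Finset.card_le_card (h4 S hS)).trans ?_
    rw [Finset.sum_congr rfl fun S _ => Finset.card_filter _ _, Finset.sum_comm]
    refine Finset.sum_le_sum fun t _ => ?_
    rw [← Finset.card_filter]
    refine (Finset.card_le_card (t := (RelTuple.elems t).image (E.induced U).component)
      fun S hS => ?_).trans (Finset.card_image_le.trans (card_elems_le t))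
    obtain ⟨hS, x, hx, hxS⟩ := Finset.mem_filter.1 hS
    obtain ⟨b, -, rfl⟩ := Finset.mem_image.1 hS
    exact Finset.mem_image.2 ⟨x, hx, component_eq_of_mem hxS⟩
  rw [Finset.sum_const, smul_eq_mul, mul_comm] at h3
  rw [← Finset.mul_sum] at h2
  exact (Finset.card_le_card h1).trans (Finset.card_biUnion_le.trans
    (h2.trans (Nat.mul_le_mul_left q h3)))

theorem alive_congr {D : RelDB σ} {k q : ℕ} {c c' : Finset (ℕ × ℕ)} (i : ℕ)
    (h : ∀ j < i, ∀ x, (j, x) ∈ c ↔ (j, x) ∈ c') : D.alive k q c i = D.alive k q c' i := by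
  induction i with
  | zero => rfl
  | succ i ih =>
    have h1 := ih fun j hj => h j (hj.trans (Nat.lt_succ_self i))
    have h2 : {x | (i, x) ∈ c} = {x | (i, x) ∈ c'} := Set.ext fun x => h i (Nat.lt_succ_self i) x
    ext b
    rw [mem_alive_succ, mem_alive_succ]
    unfold InRound
    rw [h1, h2]

/-- In each round, every element of a component of `E[U]` with small boundary is removed with
probability at least `2 ^ (-m)`, where `m` bounds the number of elements at distance at most one
from a set of size `k`. -/
theorem expect_card_alive_succ_le {D E : RelDB σ} {d k q : ℕ} (hD : D.DegreeLE d)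
    (hDE : IsTupleRemoval D E) (hk : ∀ a ∈ E.dom, (E.component a).card ≤ k) (i : ℕ)
    (a : Finset (ℕ × ℕ)) (ha : a ⊆ Finset.range i ×ˢ D.dom) :
    𝔼 w ∈ (({i} : Finset ℕ) ×ˢ D.dom).powerset, ((D.alive k q (a ∪ w) (i + 1)).card : ℝ) ≤
      (1 - (1 / 2) ^ (k * ballBound σ d 1)) * (D.alive k q a i).card +
        (1 / 2) ^ (k * ballBound σ d 1) *
          (q * (Finset.univ.sup σ.arity * (D.tuples \ E.tuples).card) : ℕ) := by
  classical
  set U := D.alive k q a i with hUdef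
  set p : ℝ := (1 / 2) ^ (k * ballBound σ d 1) with hp
  have hp0 : 0 ≤ p := by positivity
  have hU : U ⊆ D.dom := alive_subset_dom i
  have hUE : U ⊆ E.dom := hDE.1 ▸ hU
  let S : ℕ → Finset ℕ := fun b => (E.induced U).component b
  let J : ℕ → Finset ℕ := fun b => (S b).biUnion (D.ball 1)
  let good : ℕ → Prop := fun b => q * (D.cutTuples U (S b)).card ≤ (S b).card
  have hSU : ∀ b, S b ⊆ U := fun b x hx => by
    have := (mem_component.1 hx).1
    rwa [dom_induced_of_subset hUE] at this
  have hSJ : ∀ b, S b ⊆ J b := fun b x hx =>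
    Finset.mem_biUnion.2 ⟨x, hx, mem_ball_self 1 (hU (hSU b hx))⟩
  have hJD : ∀ b, J b ⊆ D.dom := fun b => Finset.biUnion_subset.2 fun x _ => D.ball_subset_dom 1 x
  have hSk : ∀ b ∈ U, (S b).card ≤ k := fun b hb =>
    (Finset.card_le_card (component_induced_subset E U b)).trans (hk b (hUE hb))
  have hJk : ∀ b ∈ U, (J b).card ≤ k * ballBound σ d 1 := fun b hb =>
    (Finset.card_biUnion_le_card_mul _ _ _ fun x hx => card_ball_le hD (hU (hSU b hx)) 1).trans
      (Nat.mul_le_mul_right _ (hSk b hb))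
  have halive : ∀ w ⊆ ({i} : Finset ℕ) ×ˢ D.dom, D.alive k q (a ∪ w) i = U := by
    intro w hw
    refine alive_congr i fun j hj x => ?_
    rw [Finset.mem_union, or_iff_left]
    intro h
    have := (Finset.mem_product.1 (hw h)).1
    rw [Finset.mem_singleton] at this
    exact hj.ne this
  -- The elements of a good component are removed if the active elements have the right trace on
  -- the neighbourhood of the component.
  have hpoint : ∀ w ⊆ ({i} : Finset ℕ) ×ˢ D.dom, ((D.alive k q (a ∪ w) (i + 1)).card : ℝ) ≤
      U.card - ∑ b ∈ U.filter good,
        (if w ∩ ({i} ×ˢ J b) = {i} ×ˢ S b then (1 : ℝ) else 0) := by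
    intro w hw
    have hmem : ∀ x, (i, x) ∈ a ∪ w ↔ (i, x) ∈ w := by
      intro x
      rw [Finset.mem_union, or_iff_right]
      intro h
      exact (Finset.mem_range.1 (Finset.mem_product.1 (ha h)).1).false
    rw [Finset.sum_boole, le_sub_iff_add_le, ← Nat.cast_add, Nat.cast_le,
      ← Finset.card_union_of_disjoint]
    · refine Finset.card_le_card (Finset.union_subset ?_ ?_)
      · rw [← halive w hw]
        exact alive_antitone (Nat.le_succ i)
      · exact (Finset.filter_subset _ _).trans (Finset.filter_subset _ _)
    · refine Finset.disjoint_left.2 fun b hb hb' => ?_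
      obtain ⟨hb', hpat⟩ := Finset.mem_filter.1 hb'
      obtain ⟨hbU, hgood⟩ := Finset.mem_filter.1 hb'
      refine (mem_alive_succ.1 hb).2 ⟨S b, mem_component.2
        ⟨by rwa [dom_induced_of_subset hUE], SimpleGraph.Reachable.refl _⟩, ?_⟩
      unfold InRound
      rw [halive w hw]
      have htrace : ∀ x ∈ J b, (i, x) ∈ w ↔ x ∈ S b := by
        intro x hx
        have := Finset.ext_iff.1 hpat (i, x)
        simpa [hx] using this
      refine isCell_component hDE hk hU hbU hgood (fun x hx => ?_) fun x hx y hy hyW => ?_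
      · exact (hmem x).2 ((htrace x (hSJ b hx)).2 hx)
      · exact (htrace y (Finset.mem_biUnion.2 ⟨x, hx, hy⟩)).1 ((hmem y).1 hyW)
  have hne : (({i} : Finset ℕ) ×ˢ D.dom).powerset.Nonempty := Finset.powerset_nonempty _
  refine (Finset.expect_le_expect fun w hw => hpoint w (Finset.mem_powerset.1 hw)).trans ?_
  rw [Finset.expect_sub_distrib, Finset.expect_const hne, Finset.expect_sum_comm]
  have hprob : ∀ b ∈ U.filter good, p ≤ 𝔼 w ∈ (({i} : Finset ℕ) ×ˢ D.dom).powerset,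
      (if w ∩ ({i} ×ˢ J b) = {i} ×ˢ S b then (1 : ℝ) else 0) := by
    intro b hb
    rw [expect_powerset_pattern (Finset.product_subset_product_right (hJD b))
      (Finset.product_subset_product_right (hSJ b)), Finset.card_product, Finset.card_singleton,
      one_mul, hp]
    exact pow_le_pow_of_le_one (by norm_num) (by norm_num) (hJk b (Finset.mem_filter.1 hb).1)
  have hsum := Finset.card_nsmul_le_sum _ _ _ hprob
  rw [nsmul_eq_mul] at hsum
  have hcard : ((U.filter good).card : ℝ) + (U.filter (fun b => ¬ good b)).card = U.card := by
    exact_mod_cast Finset.card_filter_add_card_filter_not (s := U) good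
  have hbad : ((U.filter (fun b => ¬ good b)).card : ℝ) ≤
      (q * (Finset.univ.sup σ.arity * (D.tuples \ E.tuples).card) : ℕ) :=
    Nat.cast_le.2 (card_large_boundary_le hDE hU)
  have := mul_le_mul_of_nonneg_left hbad hp0
  nlinarith

/-- The expected number of elements that are left after `i` rounds. -/
theorem expect_card_alive_le {D E : RelDB σ} {d k q : ℕ} (hD : D.DegreeLE d)
    (hDE : IsTupleRemoval D E) (hk : ∀ a ∈ E.dom, (E.component a).card ≤ k) (i : ℕ) :
    𝔼 c ∈ (Finset.range i ×ˢ D.dom).powerset, ((D.alive k q c i).card : ℝ) ≤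
      (1 - (1 / 2) ^ (k * ballBound σ d 1)) ^ i * D.size +
        (q * (Finset.univ.sup σ.arity * (D.tuples \ E.tuples).card) : ℕ) := by
  induction i with
  | zero => simp [alive, size]; positivity
  | succ i ih =>
    have hsplit : Finset.range (i + 1) ×ˢ D.dom =
        Finset.range i ×ˢ D.dom ∪ ({i} : Finset ℕ) ×ˢ D.dom := by
      ext ⟨j, x⟩
      simp only [Finset.mem_product, Finset.mem_union, Finset.mem_range, Finset.mem_singleton,
        Nat.lt_succ_iff_lt_or_eq, or_and_right]
    have hdisj : Disjoint (Finset.range i ×ˢ D.dom) (({i} : Finset ℕ) ×ˢ D.dom) := by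
      rw [Finset.disjoint_left]
      rintro ⟨j, x⟩ h1 h2
      simp only [Finset.mem_product, Finset.mem_range, Finset.mem_singleton] at h1 h2
      omega
    have hne : (Finset.range i ×ˢ D.dom).powerset.Nonempty := Finset.powerset_nonempty _
    rw [hsplit, expect_powerset_union hdisj]
    refine (Finset.expect_le_expect fun a ha =>
      expect_card_alive_succ_le hD hDE hk i a (Finset.mem_powerset.1 ha)).trans ?_
    rw [Finset.expect_add_distrib, Finset.expect_const hne, ← Finset.mul_expect]
    set p : ℝ := (1 / 2) ^ (k * ballBound σ d 1) with hp
    have hp1 : p ≤ 1 := pow_le_one₀ (by norm_num) (by norm_num)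
    have := mul_le_mul_of_nonneg_left ih (sub_nonneg.2 hp1)
    rw [pow_succ]
    nlinarith

/-! ### Local statistics -/

/-- A function of coloured databases with a distinguished element which only depends on the
isomorphism type of the coloured `R`-neighbourhood. -/
def IsLocalStat (R : ℕ) (X : RelDB σ → Finset (ℕ × ℕ) → ℕ → ℝ) : Prop :=
  ∀ ⦃D E : RelDB σ⦄ ⦃c c' : Finset (ℕ × ℕ)⦄ ⦃a : ℕ⦄ ⦃φ : ℕ → ℕ⦄, a ∈ D.dom →
    LocalIso D E R a φ → (∀ x ∈ D.ball R a, ∀ j, (j, x) ∈ c ↔ (j, φ x) ∈ c') →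
    X D c a = X E c' (φ a)

namespace IsLocalStat

variable {R : ℕ} {X : RelDB σ → Finset (ℕ × ℕ) → ℕ → ℝ}

theorem eq_inter (h : IsLocalStat R X) {D : RelDB σ} {T a : ℕ} (ha : a ∈ D.dom)
    {c : Finset (ℕ × ℕ)} (hc : c ⊆ Finset.range T ×ˢ D.dom) :
    X D c a = X D (c ∩ (Finset.range T ×ˢ D.ball R a)) a := by
  refine h ha (localIso_id D R a) fun x hx j => ?_
  rw [Finset.mem_inter, Finset.mem_product]
  exact ⟨fun hj => ⟨hj, (Finset.mem_product.1 (hc hj)).1, hx⟩, fun hj => hj.1⟩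

theorem expect_eq_ball (h : IsLocalStat R X) {D : RelDB σ} (T : ℕ) {a : ℕ} (ha : a ∈ D.dom) :
    𝔼 c ∈ (Finset.range T ×ˢ D.dom).powerset, X D c a =
      𝔼 c ∈ (Finset.range T ×ˢ D.ball R a).powerset, X D c a := by
  rw [← expect_powerset_inter (Finset.product_subset_product_right (D.ball_subset_dom R a))]
  exact Finset.expect_congr rfl fun c hc => h.eq_inter ha (Finset.mem_powerset.1 hc)

theorem expect_eq_of_typeOf_eq (h : IsLocalStat R X) {D E : RelDB σ} (T : ℕ) {a : D.dom}
    {b : E.dom} (hab : D.typeOf R a = E.typeOf R b) :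
    𝔼 c ∈ (Finset.range T ×ˢ D.dom).powerset, X D c a =
      𝔼 c ∈ (Finset.range T ×ˢ E.dom).powerset, X E c b := by
  classical
  obtain ⟨φ, hφ, hl⟩ := typeOf_eq_iff.1 hab
  obtain ⟨ψ, hψ, hinv⟩ := hl.symm a.2
  rw [h.expect_eq_ball T a.2, h.expect_eq_ball T b.2, ← hφ, ← hl.image]
  have hinv' : ∀ y ∈ (D.ball R a).image φ, φ (ψ y) = y := by
    intro y hy
    obtain ⟨x, hx, rfl⟩ := Finset.mem_image.1 hy
    rw [hinv x hx]
  have hψmem : ∀ y ∈ (D.ball R a).image φ, ψ y ∈ D.ball R a := by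
    intro y hy
    obtain ⟨x, hx, rfl⟩ := Finset.mem_image.1 hy
    rwa [hinv x hx]
  have himg : ∀ {M N : Finset ℕ} {θ : ℕ → ℕ}, (∀ x ∈ M, θ x ∈ N) →
      ∀ c ∈ (Finset.range T ×ˢ M).powerset,
        c.image (Prod.map id θ) ∈ (Finset.range T ×ˢ N).powerset := by
    intro M N θ hθ c hc
    rw [Finset.mem_powerset] at hc ⊢
    intro p hp
    obtain ⟨⟨j, x⟩, hjx, rfl⟩ := Finset.mem_image.1 hp
    have := Finset.mem_product.1 (hc hjx)
    exact Finset.mem_product.2 ⟨this.1, hθ x this.2⟩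
  have hcancel : ∀ {M : Finset ℕ} {θ χ : ℕ → ℕ}, (∀ x ∈ M, χ (θ x) = x) →
      ∀ c ∈ (Finset.range T ×ˢ M).powerset,
        (c.image (Prod.map id θ)).image (Prod.map id χ) = c := by
    intro M θ χ hθ c hc
    rw [Finset.mem_powerset] at hc
    rw [Finset.image_image]
    refine (Finset.image_congr (g := id) fun p hp => ?_).trans Finset.image_id
    exact Prod.ext rfl (hθ p.2 (Finset.mem_product.1 (hc hp)).2)
  refine Finset.expect_nbij' (fun c => c.image (Prod.map id φ)) (fun c => c.image (Prod.map id ψ))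
    (himg fun x hx => Finset.mem_image_of_mem φ hx) (himg hψmem) (hcancel hinv) (hcancel hinv')
    fun c hc => ?_
  refine h a.2 hl fun x hx j => ⟨fun hj => Finset.mem_image.2 ⟨(j, x), hj, rfl⟩, fun hj => ?_⟩
  obtain ⟨⟨j', z⟩, hz, hzx⟩ := Finset.mem_image.1 hj
  have h1 : j' = j := congrArg Prod.fst hzx
  have h2 : φ z = φ x := congrArg Prod.snd hzx
  have hzb := (Finset.mem_product.1 (Finset.mem_powerset.1 hc hz)).2
  rw [← h1, ← hl.inj hzb hx h2]
  exact hz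

/-- The expected value of the sum of a local statistic over all elements is determined by the
histogram. -/
theorem abs_expect_sub_le (h : IsLocalStat R X) (h0 : ∀ D c a, 0 ≤ X D c a)
    (h1 : ∀ D c a, X D c a ≤ 1) (T : ℕ) {d : ℕ} {D E : RelDB σ} (hD : D.DegreeLE d)
    (hE : E.DegreeLE d) :
    |𝔼 c ∈ (Finset.range T ×ˢ D.dom).powerset, ∑ a ∈ D.dom, X D c a -
      𝔼 c ∈ (Finset.range T ×ˢ E.dom).powerset, ∑ a ∈ E.dom, X E c a| ≤ histDist d R D E := by
  have hw : ∀ τ : RType σ d R, ∃ x : ℝ, |x| ≤ 1 ∧ ∀ (G : RelDB σ) (a : G.dom),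
      G.typeOf R a = τ.1 → 𝔼 c ∈ (Finset.range T ×ˢ G.dom).powerset, X G c a = x := by
    rintro ⟨τ, G, a, -, rfl⟩
    refine ⟨𝔼 c ∈ (Finset.range T ×ˢ G.dom).powerset, X G c a, ?_, fun G' a' h' =>
      h.expect_eq_of_typeOf_eq T h'⟩
    rw [abs_of_nonneg (Finset.expect_nonneg fun c _ => h0 G c a)]
    exact Finset.expect_le (Finset.powerset_nonempty _) fun c _ => h1 G c a
  choose w hw1 hw using hw
  have hsum : ∀ {G : RelDB σ} (hG : G.DegreeLE d),
      𝔼 c ∈ (Finset.range T ×ˢ G.dom).powerset, ∑ a ∈ G.dom, X G c a =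
        ∑ a : G.dom, w (G.rtype hG R a) := by
    intro G hG
    rw [Finset.expect_sum_comm, ← Finset.sum_coe_sort]
    exact Finset.sum_congr rfl fun a _ => hw (G.rtype hG R a) G a rfl
  rw [hsum hD, hsum hE]
  exact abs_sum_rtype_sub_le hD hE R w hw1

/-- The sum of a local statistic over all elements has variance linear in the size. -/
theorem expect_variance_le (h : IsLocalStat R X) (h0 : ∀ D c a, 0 ≤ X D c a)
    (h1 : ∀ D c a, X D c a ≤ 1) (T : ℕ) {d : ℕ} {D : RelDB σ} (hD : D.DegreeLE d) :
    𝔼 c ∈ (Finset.range T ×ˢ D.dom).powerset, (∑ a ∈ D.dom, X D c a -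
      𝔼 c ∈ (Finset.range T ×ˢ D.dom).powerset, ∑ a ∈ D.dom, X D c a) ^ 2 ≤
      D.size * ballBound σ d (R + R) := by
  refine expect_powerset_variance_le D.dom (fun a => Finset.range T ×ˢ D.ball R a)
    (fun a _ => Finset.product_subset_product_right (D.ball_subset_dom R a))
    (fun a c => X D c a) (fun a c => h0 D c a) (fun a c => h1 D c a)
    (fun a ha c hc => h.eq_inter ha hc) _ fun a ha => ?_
  refine (Finset.card_le_card fun b hb => ?_).trans (card_ball_le hD ha (R + R))
  obtain ⟨hbD, hb⟩ := Finset.mem_filter.1 hb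
  obtain ⟨⟨j, x⟩, hx, hx'⟩ := Finset.not_disjoint_iff.1 hb
  exact mem_ball_trans (Finset.mem_product.1 hx).2
    (mem_ball_comm hbD (Finset.mem_product.1 hx').2)

end IsLocalStat

open Classical in
/-- The indicator of being left over after `T` rounds. -/
noncomputable def aliveStat (k q T : ℕ) (D : RelDB σ) (c : Finset (ℕ × ℕ)) (a : ℕ) : ℝ :=
  if a ∈ D.alive k q c T then 1 else 0

open Classical in
/-- The indicator of having `r`-type `τ` in the database `cellDB`. -/
noncomputable def typeStat (k q T : ℕ) {d r : ℕ} (τ : RType σ d r) (D : RelDB σ)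
    (c : Finset (ℕ × ℕ)) (a : ℕ) : ℝ :=
  if ∃ h : a ∈ D.dom, (D.cellDB k q T c).typeOf r ⟨a, h⟩ = τ.1 then 1 else 0

theorem isLocalStat_aliveStat {k q T R : ℕ} (hR : T * (k + 1) ≤ R) :
    IsLocalStat (σ := σ) R (aliveStat k q T) := by
  intro D E c c' a φ ha hl hc
  exact if_congr (mem_alive_iff_of_localIso T ha (hl.mono ha hR)
    fun x hx => hc x (D.ball_mono hR a hx)) rfl rfl

theorem isLocalStat_typeStat {k q T R d r : ℕ} (τ : RType σ d r)
    (hR : T * (k + 1) + (r + 1) ≤ R) : IsLocalStat R (typeStat k q T τ) := by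
  intro D E c c' a φ ha hl hc
  have hl' : LocalIso (D.cellDB k q T c) (E.cellDB k q T c') r a φ :=
    LocalIso.cellDB ha (hl.mono ha hR) fun x hx => hc x (D.ball_mono hR a hx)
  have heq : (D.cellDB k q T c).typeOf r ⟨a, ha⟩ =
      (E.cellDB k q T c').typeOf r ⟨φ a, hl.mem_dom ha⟩ := typeOf_eq_iff.2 ⟨φ, rfl, hl'⟩
  unfold typeStat
  congr 1
  refine propext ⟨fun ⟨_, h⟩ => ⟨hl.mem_dom ha, heq ▸ h⟩, fun ⟨_, h⟩ => ⟨ha, heq.trans h⟩⟩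

theorem sum_aliveStat (k q T : ℕ) (D : RelDB σ) (c : Finset (ℕ × ℕ)) :
    ∑ a ∈ D.dom, aliveStat k q T D c a = (D.alive k q c T).card := by
  classical
  unfold aliveStat
  rw [Finset.sum_boole, Finset.filter_mem_eq_inter, Finset.inter_eq_right.2 (alive_subset_dom T)]

theorem sum_typeStat (k q T : ℕ) {d r : ℕ} (τ : RType σ d r) (D : RelDB σ)
    (c : Finset (ℕ × ℕ)) :
    ∑ a ∈ D.dom, typeStat k q T τ D c a = (D.cellDB k q T c).hist d r τ := by
  classical
  unfold typeStat hist
  rw [← Finset.sum_coe_sort, ← Finset.sum_boole]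
  refine Finset.sum_congr rfl fun a _ => ?_
  congr 1
  exact propext ⟨fun ⟨_, h⟩ => h, fun h => ⟨a.2, h⟩⟩

/-! ### Existence of a locality radius -/

/-- The number of tuples removed by the partitioning procedure. -/
noncomputable def removed (k q T : ℕ) (D : RelDB σ) (c : Finset (ℕ × ℕ)) : ℝ :=
  ((D.tuples \ (D.cellDB k q T c).tuples).card : ℝ)

theorem removed_nonneg (k q T : ℕ) (D : RelDB σ) (c : Finset (ℕ × ℕ)) :
    0 ≤ removed k q T D c := Nat.cast_nonneg _

theorem expect_removed_le {d k q T : ℕ} (hq : 0 < q) {D : RelDB σ} (hD : D.DegreeLE d) :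
    𝔼 c ∈ (Finset.range T ×ˢ D.dom).powerset, removed k q T D c ≤ D.size / q +
      d * 𝔼 c ∈ (Finset.range T ×ˢ D.dom).powerset, ((D.alive k q c T).card : ℝ) := by
  have hq' : (0 : ℝ) < q := Nat.cast_pos.2 hq
  have hpoint : ∀ c, removed k q T D c ≤ D.size / q + d * ((D.alive k q c T).card : ℝ) := by
    intro c
    have h : (q : ℝ) * removed k q T D c ≤ D.size + q * (d * (D.alive k q c T).card) := by
      unfold removed size
      exact_mod_cast card_removed_le hD
    rw [div_add' _ _ _ hq'.ne', le_div_iff₀ hq']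
    linarith
  refine (Finset.expect_le_expect fun c _ => hpoint c).trans ?_
  rw [Finset.expect_add_distrib, Finset.expect_const (Finset.powerset_nonempty _),
    ← Finset.mul_expect]

/-- In a large database, some outcome of the partitioning procedure removes few tuples and has a
histogram close to the expected one. -/
theorem exists_partition_near_mean {d k q T r : ℕ} {D : RelDB σ} (hD : D.DegreeLE d) {η θ : ℝ}
    (hη : 0 < η) (hθ : 0 < θ) (hsize : 0 < D.size)
    (hlarge : 2 * (Fintype.card (RType σ d r) *
      ballBound σ d ((T * (k + 1) + (r + 1)) + (T * (k + 1) + (r + 1)))) ≤ θ ^ 2 * D.size)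
    (hrem : 𝔼 c ∈ (Finset.range T ×ˢ D.dom).powerset, removed k q T D c ≤ η / 2 * D.size) :
    ∃ c, removed k q T D c ≤ η * D.size ∧ ∀ τ : RType σ d r,
      |((D.cellDB k q T c).hist d r τ : ℝ) - 𝔼 c ∈ (Finset.range T ×ˢ D.dom).powerset,
        ∑ a ∈ D.dom, typeStat k q T τ D c a| ≤ θ * D.size := by
  have hn : (0 : ℝ) < D.size := Nat.cast_pos.2 hsize
  set B := ballBound σ d ((T * (k + 1) + (r + 1)) + (T * (k + 1) + (r + 1))) with hB
  set Ω := (Finset.range T ×ˢ D.dom).powerset with hΩ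
  have hne : Ω.Nonempty := Finset.powerset_nonempty _
  let Y : RType σ d r → Finset (ℕ × ℕ) → ℝ := fun τ c =>
    (∑ a ∈ D.dom, typeStat k q T τ D c a - 𝔼 c ∈ Ω, ∑ a ∈ D.dom, typeStat k q T τ D c a) ^ 2
  have hY : ∀ τ, 𝔼 c ∈ Ω, Y τ c ≤ D.size * B := fun τ =>
    (isLocalStat_typeStat τ le_rfl).expect_variance_le
      (fun D c a => by unfold typeStat; split_ifs <;> norm_num)
      (fun D c a => by unfold typeStat; split_ifs <;> norm_num) T hD
  have hmean : 𝔼 c ∈ Ω, (removed k q T D c / (η * D.size) +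
      ∑ τ, Y τ c / (θ * D.size) ^ 2) ≤ 1 := by
    rw [Finset.expect_add_distrib, Finset.expect_sum_comm, ← Finset.expect_div]
    have h1 : (𝔼 c ∈ Ω, removed k q T D c) / (η * D.size) ≤ 1 / 2 := by
      rw [div_le_iff₀ (by positivity)]
      linarith
    have h2 : ∀ τ ∈ (Finset.univ : Finset (RType σ d r)),
        𝔼 c ∈ Ω, Y τ c / (θ * D.size) ^ 2 ≤ B / (θ ^ 2 * D.size) := by
      intro τ _
      rw [← Finset.expect_div, div_le_div_iff₀ (by positivity) (by positivity)]
      have := mul_le_mul_of_nonneg_right (hY τ) (by positivity : 0 ≤ θ ^ 2 * (D.size : ℝ))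
      nlinarith
    have h3 := Finset.sum_le_card_nsmul _ _ _ h2
    rw [nsmul_eq_mul, Finset.card_univ, mul_div_assoc'] at h3
    have h4 : (Fintype.card (RType σ d r) * B : ℝ) / (θ ^ 2 * D.size) ≤ 1 / 2 := by
      rw [div_le_iff₀ (by positivity)]
      linarith
    linarith
  obtain ⟨c, -, hc⟩ := Finset.exists_le_of_expect_le hne hmean
  have hY0 : ∀ τ, 0 ≤ Y τ c / (θ * D.size) ^ 2 := fun τ => by positivity
  have hr0 : 0 ≤ removed k q T D c / (η * D.size) :=
    div_nonneg (removed_nonneg _ _ _ _ _) (by positivity)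
  refine ⟨c, ?_, fun τ => ?_⟩
  · have h1 : removed k q T D c / (η * D.size) ≤ 1 := by
      linarith [Finset.sum_nonneg fun τ (_ : τ ∈ Finset.univ) => hY0 τ]
    rwa [div_le_one (by positivity)] at h1
  · have h1 : Y τ c / (θ * D.size) ^ 2 ≤ 1 := by
      linarith [Finset.single_le_sum (fun τ (_ : τ ∈ Finset.univ) => hY0 τ) (Finset.mem_univ τ)]
    rw [div_le_one (by positivity)] at h1
    rw [← sum_typeStat]
    exact abs_le_of_sq_le_sq h1 (by positivity)

theorem histDist_eq_zero_of_lt_one {d r : ℕ} {D E : RelDB σ} (h : histDist d r D E < 1) :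
    histDist d r D E = 0 := by
  rw [histDist_eq_sum] at h ⊢
  refine Finset.sum_eq_zero fun τ hτ => ?_
  have h1 : |(D.hist d r τ : ℝ) - E.hist d r τ| < 1 :=
    (Finset.single_le_sum (f := fun τ => |(D.hist d r τ : ℝ) - E.hist d r τ|)
      (fun _ _ => abs_nonneg _) hτ).trans_lt h
  have h2 : |(D.hist d r τ : ℤ) - E.hist d r τ| < 1 := by exact_mod_cast h1
  have h3 := Int.abs_lt_one_iff.1 h2
  have h4 : (D.hist d r τ : ℝ) - E.hist d r τ = 0 := by exact_mod_cast h3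
  rw [h4, abs_zero]

/-- Small databases with equal histograms of large radius are isomorphic. -/
theorem distPM_eq_zero_of_hist_eq {d R : ℕ} {D E : RelDB σ} (hD : D.DegreeLE d)
    (hE : E.DegreeLE d) (hR : 1 ≤ R) (hDR : D.size ≤ R) (hER : E.size ≤ R)
    (h : histDist d R D E = 0) : distPM D E = 0 := by
  have h1 := distPM_le_of_small hR (D := D) (E := E) ⟨rfl, subset_rfl⟩ ⟨rfl, subset_rfl⟩ hD hE
    (fun a _ => (Finset.card_le_card (D.ball_subset_dom _ _)).trans hDR)
    (fun a _ => (Finset.card_le_card (E.ball_subset_dom _ _)).trans hER)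
  rw [h] at h1
  simpa using h1

/-- On a hyperfinite database, few elements are expected to be left over. -/
theorem expect_alive_le_of_isPartition {d k q T : ℕ} {η δ : ℝ}
    (hδη : d * (q * (Finset.univ.sup σ.arity * δ)) ≤ η / 16)
    (hTη : d * (1 - (1 / 2) ^ (k * ballBound σ d 1)) ^ T ≤ η / 16) {D E : RelDB σ}
    (hD : D.DegreeLE d) (hE : IsPartition δ k D E) :
    d * 𝔼 c ∈ (Finset.range T ×ˢ D.dom).powerset, ((D.alive k q c T).card : ℝ) ≤
      η / 8 * D.size := by
  have hd0 : (0 : ℝ) ≤ d := Nat.cast_nonneg d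
  have h1 := mul_le_mul_of_nonneg_left (expect_card_alive_le (q := q) hD hE.1 hE.2.2 T) hd0
  push_cast at h1
  have h3 := mul_le_mul_of_nonneg_right hTη (Nat.cast_nonneg (α := ℝ) D.size)
  have h4 := mul_le_mul_of_nonneg_right hδη (Nat.cast_nonneg (α := ℝ) D.size)
  have h5 : (d : ℝ) * (q * (((Finset.univ.sup σ.arity : ℕ) : ℝ) *
      ((D.tuples \ E.tuples).card : ℝ))) ≤
      d * (q * (((Finset.univ.sup σ.arity : ℕ) : ℝ) * (δ * D.size))) := by
    have h2 := hE.2.1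
    gcongr
  have h6 : (d : ℝ) * (q * (((Finset.univ.sup σ.arity : ℕ) : ℝ) * (δ * D.size))) =
    d * (q * (((Finset.univ.sup σ.arity : ℕ) : ℝ) * δ)) * D.size := by ring
  linarith

/-- Whether few elements are left over is visible in the histogram. -/
theorem expect_alive_le_of_histDist {d k q T R : ℕ} (hR : T * (k + 1) ≤ R) {x y : ℝ}
    {D D' : RelDB σ} (hD : D.DegreeLE d) (hD' : D'.DegreeLE d) (hh : histDist d R D D' ≤ y)
    (hx : d * 𝔼 c ∈ (Finset.range T ×ˢ D.dom).powerset, ((D.alive k q c T).card : ℝ) ≤ x) :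
    d * 𝔼 c ∈ (Finset.range T ×ˢ D'.dom).powerset, ((D'.alive k q c T).card : ℝ) ≤
      x + d * y := by
  have h1 := (isLocalStat_aliveStat (σ := σ) (k := k) (q := q) (T := T) hR).abs_expect_sub_le
    (fun D c a => by unfold aliveStat; split_ifs <;> norm_num)
    (fun D c a => by unfold aliveStat; split_ifs <;> norm_num) T hD hD'
  simp only [sum_aliveStat] at h1
  have h2 := mul_le_mul_of_nonneg_left (abs_le.1 (h1.trans hh)).1 (Nat.cast_nonneg (α := ℝ) d)
  linarith

/-- If the histograms of `cellDB` are close to their means then they are close to each other. -/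
theorem histDist_cellDB_le {d k q T R r : ℕ} (hR : T * (k + 1) + (r + 1) ≤ R) {x y z : ℝ}
    {D D' : RelDB σ} (hD : D.DegreeLE d) (hD' : D'.DegreeLE d) (hh : histDist d R D D' ≤ z)
    {c c' : Finset (ℕ × ℕ)}
    (hc : ∀ τ : RType σ d r, |((D.cellDB k q T c).hist d r τ : ℝ) -
      𝔼 c ∈ (Finset.range T ×ˢ D.dom).powerset, ∑ a ∈ D.dom, typeStat k q T τ D c a| ≤ x)
    (hc' : ∀ τ : RType σ d r, |((D'.cellDB k q T c').hist d r τ : ℝ) -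
      𝔼 c ∈ (Finset.range T ×ˢ D'.dom).powerset, ∑ a ∈ D'.dom, typeStat k q T τ D' c a| ≤ y) :
    histDist d r (D'.cellDB k q T c') (D.cellDB k q T c) ≤
      Fintype.card (RType σ d r) * (x + y + z) := by
  rw [histDist_eq_sum]
  have hterm : ∀ τ ∈ (Finset.univ : Finset (RType σ d r)),
      |((D'.cellDB k q T c').hist d r τ : ℝ) - (D.cellDB k q T c).hist d r τ| ≤ x + y + z := by
    intro τ _
    have h1 := (isLocalStat_typeStat (q := q) τ hR).abs_expect_sub_le
      (fun D c a => by unfold typeStat; split_ifs <;> norm_num)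
      (fun D c a => by unfold typeStat; split_ifs <;> norm_num) T hD hD'
    obtain ⟨h2, h2'⟩ := abs_le.1 (h1.trans hh)
    obtain ⟨h3, h3'⟩ := abs_le.1 (hc τ)
    obtain ⟨h4, h4'⟩ := abs_le.1 (hc' τ)
    rw [abs_le]
    constructor <;> linarith
  have hsum := Finset.sum_le_card_nsmul _ _ _ hterm
  rwa [nsmul_eq_mul, Finset.card_univ] at hsum

/-- Run with the same parameters, the partitioning procedure yields nearly the same histogram of
components on two databases with nearly the same histogram of large radius. -/
theorem distPM_le_of_partition {d k q T R n₀ : ℕ} (hk : 1 ≤ k) (hq : 0 < q)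
    (hR : T * (k + 1) + (k + 1) ≤ R) {η θ lam δ : ℝ} (hη : 0 < η) (hθ : 0 < θ)
    (hlam : lam ≤ 1)
    (hqη : 8 ≤ η * q) (hδη : d * (q * (Finset.univ.sup σ.arity * δ)) ≤ η / 16)
    (hTη : d * (1 - (1 / 2) ^ (k * ballBound σ d 1)) ^ T ≤ η / 16)
    (hθη : Fintype.card (RType σ d k) * (4 * θ) ≤ η / 2)
    (hlη : Fintype.card (RType σ d k) * lam ≤ η / 2) (hldη : d * lam ≤ η / 8) (hn₀ : 0 < n₀)
    (hlarge : 2 * (Fintype.card (RType σ d k) *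
      ballBound σ d ((T * (k + 1) + (k + 1)) + (T * (k + 1) + (k + 1)))) ≤ θ ^ 2 * n₀)
    {D D' E : RelDB σ} (hD : D.DegreeLE d) (hD' : D'.DegreeLE d) (hE : IsPartition δ k D E)
    (hh : histDist d R D D' ≤ lam * min (D.size : ℝ) D'.size) (hDn : n₀ ≤ D.size)
    (hDn' : n₀ ≤ D'.size) :
    (distPM D' D : ℝ) ≤ 5 * η * min (D.size : ℝ) D'.size := by
  set m : ℝ := min (D.size : ℝ) D'.size with hm
  have hDn1 : (n₀ : ℝ) ≤ D.size := Nat.cast_le.2 hDn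
  have hDn1' : (n₀ : ℝ) ≤ D'.size := Nat.cast_le.2 hDn'
  have hn₀' : (0 : ℝ) < n₀ := Nat.cast_pos.2 hn₀
  have hmD : m ≤ D.size := min_le_left _ _
  have hmD' : m ≤ D'.size := min_le_right _ _
  have hm0 : 0 < m := lt_min (by linarith) (by linarith)
  have hlm : lam * m ≤ m := mul_le_of_le_one_left hm0.le hlam
  have hdiff := abs_le.1 ((abs_size_sub_le hD hD' R).trans (hh.trans hlm))
  have hD2 : (D.size : ℝ) ≤ 2 * m := by
    rcases min_choice (D.size : ℝ) D'.size with h | h <;> rw [← hm] at h <;> linarith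
  have hD2' : (D'.size : ℝ) ≤ 2 * m := by
    rcases min_choice (D.size : ℝ) D'.size with h | h <;> rw [← hm] at h <;> linarith
  have hq' : (0 : ℝ) < q := Nat.cast_pos.2 hq
  have haD := expect_alive_le_of_isPartition hδη hTη hD hE
  have haD' := expect_alive_le_of_histDist (q := q) (by omega) hD hD' hh haD
  have hl1 : d * (lam * m) ≤ η / 8 * D'.size := by
    have h3 := mul_le_mul_of_nonneg_right hldη hm0.le
    have h5 := mul_le_mul_of_nonneg_left hmD' hη.le
    linarith
  have hDD' : η * D.size ≤ η * (2 * D'.size) :=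
    mul_le_mul_of_nonneg_left (by linarith) hη.le
  have hquot : ∀ G : RelDB σ, (G.size : ℝ) / q ≤ η / 8 * G.size := by
    intro G
    rw [div_le_iff₀ hq']
    have := mul_le_mul_of_nonneg_right hqη (Nat.cast_nonneg (α := ℝ) G.size)
    linarith
  have hposD : 0 < D.size := by omega
  have hposD' : 0 < D'.size := by omega
  have hηD : 0 ≤ η * D.size := by positivity
  obtain ⟨c, hc1, hc2⟩ := exists_partition_near_mean (k := k) (q := q) (T := T) (r := k) hD hη hθ
    hposD (hlarge.trans (mul_le_mul_of_nonneg_left hDn1 (sq_nonneg θ)))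
    ((expect_removed_le hq hD).trans (by have := hquot D; linarith))
  obtain ⟨c', hc1', hc2'⟩ := exists_partition_near_mean (k := k) (q := q) (T := T) (r := k) hD' hη
    hθ hposD' (hlarge.trans (mul_le_mul_of_nonneg_left hDn1' (sq_nonneg θ)))
    ((expect_removed_le hq hD').trans (by have := hquot D'; linarith))
  have hhist : histDist d k (D'.cellDB k q T c') (D.cellDB k q T c) ≤ η * m := by
    have h1 := mul_le_mul_of_nonneg_right hθη hm0.le
    have h2 := mul_le_mul_of_nonneg_right hlη hm0.le
    have h3 : (Fintype.card (RType σ d k) : ℝ) * (θ * D.size + θ * D'.size + lam * m) ≤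
        Fintype.card (RType σ d k) * (4 * θ * m + lam * m) := by
      refine mul_le_mul_of_nonneg_left ?_ (Nat.cast_nonneg _)
      have h5 := mul_le_mul_of_nonneg_left hD2 hθ.le
      have h6 := mul_le_mul_of_nonneg_left hD2' hθ.le
      linarith
    have h4 := histDist_cellDB_le hR hD hD' hh hc2 hc2'
    linarith
  have hfin := distPM_le_of_small hk
    (isTupleRemoval_cellDB (D := D') (k := k) (q := q) (T := T) (c := c'))
    (isTupleRemoval_cellDB (D := D) (k := k) (q := q) (T := T) (c := c))
    (hD'.of_isTupleRemoval isTupleRemoval_cellDB) (hD.of_isTupleRemoval isTupleRemoval_cellDB)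
    (fun a ha => card_ball_cellDB_le (D := D') hk ha _)
    (fun a ha => card_ball_cellDB_le (D := D) hk ha _)
  have h5 := mul_le_mul_of_nonneg_left hD2 hη.le
  have h6 := mul_le_mul_of_nonneg_left hD2' hη.le
  unfold removed at hc1 hc1'
  linarith

/-- A hyperfinite property has a locality radius. The parameters are chosen in the order `q`, `δ`,
`k`, `T`, `θ`, `n₀`, `lam`; the radius is large enough both for the statistics of the partitioning
procedure and to contain every component of a database with fewer than `n₀` elements. -/
theorem exists_isLocalityRadius {d : ℕ} (hd : 1 ≤ d) {C P : Set (RelDB σ)}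
    (hCdeg : ∀ D ∈ C, D.DegreeLE d) (hPC : P ⊆ C) (hhyp : HyperfiniteOn P C) {ε : ℝ}
    (hε : 0 < ε) : ∃ r, IsLocalityRadius d C P ε r := by
  obtain ⟨ρ, hρ⟩ := hhyp
  set A := Finset.univ.sup σ.arity with hA
  have hd0 : (0 : ℝ) < d := Nat.cast_pos.2 hd
  have hd1 : (1 : ℝ) ≤ d := Nat.one_le_cast.2 hd
  let η : ℝ := ε / 5
  have hη : 0 < η := by positivity
  obtain ⟨q, hq⟩ := exists_nat_gt (8 / η)
  have hq0 : (0 : ℝ) < q := lt_trans (by positivity) hq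
  have hqη : 8 ≤ η * q := by
    rw [div_lt_iff₀ hη] at hq
    linarith
  let δ : ℝ := min 1 (η / (16 * (d * q * A + 1)))
  have hδ0 : 0 < δ := lt_min one_pos (by positivity)
  have hδη : d * (q * (A * δ)) ≤ η / 16 := by
    have h1 : δ ≤ η / (16 * (d * q * A + 1)) := min_le_right _ _
    rw [le_div_iff₀ (by positivity)] at h1
    nlinarith
  let k := ρ δ + 1
  let p : ℝ := (1 / 2) ^ (k * ballBound σ d 1)
  have hp0 : 0 < p := by positivity
  obtain ⟨T, hT⟩ := exists_pow_lt_of_lt_one (show 0 < η / (16 * d) by positivity)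
    (show 1 - p < 1 by linarith)
  have hTη : d * (1 - p) ^ T ≤ η / 16 := by
    rw [lt_div_iff₀ (by positivity)] at hT
    linarith
  set M := Fintype.card (RType σ d k) with hM
  let θ : ℝ := η / (8 * (M + 1))
  have hθ : 0 < θ := by positivity
  have hθη : M * (4 * θ) ≤ η / 2 := by
    have h1 : θ * (8 * (M + 1)) = η := div_mul_cancel₀ _ (by positivity)
    nlinarith
  set R₁ := T * (k + 1) + (k + 1) with hR₁
  obtain ⟨n₀, hn₀⟩ := exists_nat_gt (2 * (M * ballBound σ d (R₁ + R₁)) / θ ^ 2 : ℝ)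
  have hn₀0 : (0 : ℝ) < n₀ := lt_of_le_of_lt (by positivity) hn₀
  have hlarge : 2 * (M * ballBound σ d (R₁ + R₁)) ≤ θ ^ 2 * n₀ := by
    rw [div_lt_iff₀ (by positivity)] at hn₀
    linarith
  let lam : ℝ := min (min 1 (1 / n₀)) (min (η / (8 * d)) (η / (2 * (M + 1))))
  have hl0 : 0 < lam := by
    refine lt_min (lt_min one_pos ?_) (lt_min ?_ ?_) <;> positivity
  have hl1 : lam ≤ 1 := (min_le_left _ _).trans (min_le_left _ _)
  have hln : lam * n₀ ≤ 1 := by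
    have : lam ≤ 1 / n₀ := (min_le_left _ _).trans (min_le_right _ _)
    rwa [le_div_iff₀ hn₀0] at this
  have hld : d * lam ≤ η / 8 := by
    have : lam ≤ η / (8 * d) := (min_le_right _ _).trans (min_le_left _ _)
    rw [le_div_iff₀ (by positivity)] at this
    linarith
  have hlM : M * lam ≤ η / 2 := by
    have : lam ≤ η / (2 * (M + 1)) := (min_le_right _ _).trans (min_le_right _ _)
    rw [le_div_iff₀ (by positivity)] at this
    nlinarith
  refine ⟨R₁ + n₀, lam, hl0, hl1, fun D hD D' hD' hh => ⟨D, hD, ?_⟩⟩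
  have hDd := hCdeg D (hPC hD)
  have hDd' := hCdeg D' hD'
  have hm0 : (0 : ℝ) ≤ min (D'.size : ℝ) D.size := le_min (Nat.cast_nonneg _) (Nat.cast_nonneg _)
  unfold Close
  by_cases hsmall : D.size < n₀ ∨ D'.size < n₀
  · have hlt : min (D.size : ℝ) D'.size < n₀ := by
      rcases hsmall with h | h
      · exact (min_le_left _ _).trans_lt (Nat.cast_lt.2 h)
      · exact (min_le_right _ _).trans_lt (Nat.cast_lt.2 h)
    have hzero := histDist_eq_zero_of_lt_one
      (lt_of_le_of_lt hh ((mul_lt_mul_of_pos_left hlt hl0).trans_le hln))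
    have hsize := abs_size_sub_le hDd hDd' (R₁ + n₀)
    rw [hzero] at hsize
    have hsize' : D.size = D'.size := by
      have := sub_eq_zero.1 (abs_eq_zero.1 (hsize.antisymm (abs_nonneg _)))
      exact_mod_cast this
    rw [histDist_comm] at hzero
    rw [distPM_eq_zero_of_hist_eq hDd' hDd (by omega) (by omega) (by omega) hzero, Nat.cast_zero]
    positivity
  · push Not at hsmall
    obtain ⟨E, -, hE⟩ := hρ δ hδ0 (min_le_left _ _) D hD
    have h1 := distPM_le_of_partition (q := q) (R := R₁ + n₀) (Nat.le_add_left 1 (ρ δ))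
      (Nat.cast_pos.1 hq0) (Nat.le_add_right _ _) hη hθ hl1 hqη hδη hTη hθη hlM hld
      (Nat.cast_pos.1 hn₀0) hlarge hDd hDd'
      (E := E) ⟨hE.1, hE.2.1, fun a ha => (hE.2.2 a ha).trans (Nat.le_succ _)⟩ hh hsmall.1 hsmall.2
    refine h1.trans ?_
    rw [min_comm]
    have h2 : 5 * η = ε := by simp only [η]; ring
    rw [h2]
    exact mul_le_mul_of_nonneg_right (le_mul_of_one_le_right hε.le hd1) hm0

end RelDB

/-! ### Scaling in semilinear sets -/

/-- Up to a bounded error, linear sets of vectors are closed under multiplication by nonnegative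
reals: scale the coefficients of the periods and round them down. -/
theorem IsLinearSet.exists_near_smul {ι : Type*} [Fintype ι] {H : Set (ι → ℕ)}
    (hH : IsLinearSet H) : ∃ K : ℝ, 0 ≤ K ∧ ∀ h ∈ H, ∀ s : ℝ, 0 ≤ s →
      ∃ h' ∈ H, ∑ i, |(h' i : ℝ) - s * h i| ≤ K * (1 + s) := by
  obtain ⟨a, t, rfl⟩ := isLinearSet_iff.1 hH
  refine ⟨∑ i, ((a i : ℝ) + ∑ v ∈ t, (v i : ℝ)), by positivity, ?_⟩
  rintro _ ⟨y, hy, rfl⟩ s hs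
  obtain ⟨n, -, rfl⟩ := AddSubmonoid.mem_closure_finset.1 hy
  refine ⟨a + ∑ v ∈ t, ⌊s * n v⌋₊ • v, ⟨_, sum_mem fun v hv =>
    AddSubmonoid.nsmul_mem _ (AddSubmonoid.subset_closure hv) _, rfl⟩, ?_⟩
  rw [Finset.sum_mul]
  refine Finset.sum_le_sum fun i _ => ?_
  have hfl : ∀ v ∈ t, |((⌊s * n v⌋₊ : ℝ) - s * n v) * v i| ≤ v i := by
    intro v _
    have h1 := Nat.floor_le (show 0 ≤ s * n v by positivity)
    have h2 := Nat.lt_floor_add_one (s * n v)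
    rw [abs_mul, Nat.abs_cast]
    refine mul_le_of_le_one_left (Nat.cast_nonneg _) ?_
    rw [abs_le]
    constructor <;> linarith
  have heq : (((a + ∑ v ∈ t, ⌊s * n v⌋₊ • v) i : ℕ) : ℝ) -
      s * ((a +ᵥ ∑ v ∈ t, n v • v) i : ℕ) =
      (a i - s * a i) + ∑ v ∈ t, ((⌊s * n v⌋₊ : ℝ) - s * n v) * v i := by
    simp only [vadd_eq_add, Pi.add_apply, Finset.sum_apply, Pi.smul_apply, smul_eq_mul]
    push_cast
    simp only [sub_mul, Finset.sum_sub_distrib, mul_add, Finset.mul_sum, mul_assoc]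
    ring
  have hsum : |∑ v ∈ t, ((⌊s * n v⌋₊ : ℝ) - s * n v) * v i| ≤ ∑ v ∈ t, (v i : ℝ) :=
    (Finset.abs_sum_le_sum_abs _ _).trans (Finset.sum_le_sum hfl)
  have ha : |(a i : ℝ) - s * a i| ≤ a i * (1 + s) := by
    have h1 : (0 : ℝ) ≤ a i := Nat.cast_nonneg _
    have h2 : 0 ≤ s * a i := mul_nonneg hs h1
    rw [abs_le]
    constructor <;> linarith
  have hnn : 0 ≤ (∑ v ∈ t, (v i : ℝ)) * s := mul_nonneg (by positivity) hs
  refine (le_of_eq (congrArg abs heq)).trans ((abs_add_le _ _).trans ?_)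
  linarith

theorem IsSemilinearSet.exists_near_smul {ι : Type*} [Fintype ι] {H : Set (ι → ℕ)}
    (hH : IsSemilinearSet H) : ∃ K : ℕ, 0 < K ∧ ∀ h ∈ H, ∀ s : ℝ, 0 ≤ s →
      ∃ h' ∈ H, ∑ i, |(h' i : ℝ) - s * h i| ≤ K * (1 + s) := by
  obtain ⟨S, hS, rfl⟩ := isSemilinearSet_iff.1 hH
  have hK : ∀ L ∈ S, ∃ K : ℝ, 0 ≤ K ∧ ∀ h ∈ L, ∀ s : ℝ, 0 ≤ s →
      ∃ h' ∈ L, ∑ i, |(h' i : ℝ) - s * h i| ≤ K * (1 + s) := fun L hL => (hS L hL).exists_near_smul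
  choose! K hK0 hK using hK
  obtain ⟨N, hN⟩ := exists_nat_gt (∑ L ∈ S, K L)
  refine ⟨N, Nat.cast_pos.1 ((Finset.sum_nonneg hK0).trans_lt hN), ?_⟩
  rintro h ⟨L, hL, hh⟩ s hs
  obtain ⟨h', hh', hle⟩ := hK L hL h hh s hs
  refine ⟨h', ⟨L, hL, hh'⟩, hle.trans (mul_le_mul_of_nonneg_right ?_ (by linarith))⟩
  exact (Finset.single_le_sum hK0 hL).trans hN.le

namespace RelDB

variable {σ : RelSchema}

/-- If the histogram of `E` is nearly `N / D.size` times that of `D` then the distribution vectors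
of `D` and `E` are close. -/
theorem dvDist_le_of_near {d r : ℕ} {D E : RelDB σ} (hD : D.DegreeLE d) (hE : E.DegreeLE d)
    (hDs : 0 < D.size) {N x : ℝ} (hN : 0 < N)
    (h : ∑ τ : RType σ d r, |(E.hist d r τ : ℝ) - N / D.size * D.hist d r τ| ≤ x) :
    |(E.size : ℝ) - N| ≤ x ∧ dvDist d r D E ≤ 2 * x / N := by
  have hn : (0 : ℝ) < D.size := Nat.cast_pos.2 hDs
  have hsize : |(E.size : ℝ) - N| ≤ x := by
    refine le_trans ?_ h
    refine le_trans (le_of_eq ?_) (Finset.abs_sum_le_sum_abs _ _)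
    rw [Finset.sum_sub_distrib, ← Finset.mul_sum, sum_hist hD, sum_hist hE,
      div_mul_cancel₀ _ hn.ne']
  refine ⟨hsize, ?_⟩
  have hterm : ∀ τ ∈ (Finset.univ : Finset (RType σ d r)), |D.dv d r τ - E.dv d r τ| ≤
      |(E.hist d r τ : ℝ) - N / D.size * D.hist d r τ| / N +
        E.hist d r τ * |1 / N - 1 / E.size| := by
    intro τ _
    have e : D.dv d r τ - E.dv d r τ =
        -((E.hist d r τ : ℝ) - N / D.size * D.hist d r τ) / N +
          E.hist d r τ * (1 / N - 1 / E.size) := by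
      unfold dv
      field_simp
      ring
    rw [e]
    refine (abs_add_le _ _).trans (le_of_eq ?_)
    rw [abs_div, abs_neg, abs_mul, abs_of_pos hN, Nat.abs_cast]
  have hE2 : (E.size : ℝ) * |1 / N - 1 / E.size| ≤ x / N := by
    rcases Nat.eq_zero_or_pos E.size with h0 | h0
    · rw [h0, Nat.cast_zero, zero_mul]
      exact div_nonneg ((abs_nonneg _).trans hsize) hN.le
    · have h0' : (0 : ℝ) < E.size := Nat.cast_pos.2 h0
      have e : (E.size : ℝ) * (1 / N - 1 / E.size) = (E.size - N) / N := by field_simp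
      calc (E.size : ℝ) * |1 / N - 1 / E.size| = |(E.size : ℝ) * (1 / N - 1 / E.size)| := by
            rw [abs_mul, Nat.abs_cast]
        _ = |(E.size : ℝ) - N| / N := by rw [e, abs_div, abs_of_pos hN]
        _ ≤ x / N := div_le_div_of_nonneg_right hsize hN.le
  rw [dvDist_eq_sum]
  refine (Finset.sum_le_sum hterm).trans ?_
  rw [Finset.sum_add_distrib, ← Finset.sum_div, ← Finset.sum_mul, sum_hist hE]
  have h3 := div_le_div_of_nonneg_right h hN.le
  have h4 : 2 * x / N = x / N + x / N := by ring
  linarith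

/-- If the histogram of `F` is nearly that of `E` scaled to the size of `D`, then the distance of
the histograms of `F` and `D` is controlled by that of the distribution vectors of `D` and `E`. -/
theorem histDist_le_of_near {d r : ℕ} {D E F : RelDB σ} (hDs : 0 < D.size) {x : ℝ}
    (h : ∑ τ : RType σ d r,
      |(F.hist d r τ : ℝ) - D.size / E.size * E.hist d r τ| ≤ x) :
    histDist d r F D ≤ x + D.size * dvDist d r D E := by
  have hn : (0 : ℝ) < D.size := Nat.cast_pos.2 hDs
  rw [histDist_eq_sum, dvDist_eq_sum, Finset.mul_sum]
  refine le_trans ?_ (add_le_add_left h _)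
  rw [← Finset.sum_add_distrib]
  refine Finset.sum_le_sum fun τ _ => ?_
  have e : (F.hist d r τ : ℝ) - D.hist d r τ =
      (F.hist d r τ - D.size / E.size * E.hist d r τ) -
        D.size * (D.dv d r τ - E.dv d r τ) := by
    unfold dv
    rw [mul_sub, mul_div_cancel₀ _ hn.ne']
    ring
  rw [e]
  refine (abs_sub _ _).trans (le_of_eq ?_)
  rw [abs_mul, Nat.abs_cast]

end RelDB

theorem mainTheorem3 (σ : RelSchema) (d : ℕ) (hd : 2 ≤ d)
    (C P : Set (RelDB σ))
    (hCdeg : ∀ D ∈ C, D.DegreeLE d)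
    (hCiso : RelDB.IsoClosed C) (hCrem : RelDB.RemovalClosed C)
    (hPC : P ⊆ C) (hPiso : RelDB.IsoClosed P)
    (hhyp : RelDB.HyperfiniteOn P C)
    (ε : ℝ) (hε0 : 0 < ε) (hε1 : ε ≤ 1) :
    (∃ r : ℕ, RelDB.IsLocalityRadius d C P ε r) ∧
    ∀ r : ℕ, RelDB.IsLocalityRadius d C P ε r →
      IsSemilinearSet (RelDB.hist d r '' P) →
      ∃ (nmin nmax : ℕ) (f μ : ℝ), 0 < f ∧ f < 1 ∧ 0 < μ ∧ μ < 1 ∧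
        ∀ D ∈ C, nmax < D.size →
          (D ∈ P → ∃ D' ∈ P, nmin ≤ D'.size ∧ D'.size ≤ nmax ∧
            RelDB.dvDist d r D D' ≤ f - μ) ∧
          (RelDB.FarFrom d ε P D → ∀ D' ∈ P, nmin ≤ D'.size → D'.size ≤ nmax →
            f + μ < RelDB.dvDist d r D D') := by
  refine ⟨RelDB.exists_isLocalityRadius (by omega) hCdeg hPC hhyp hε0, ?_⟩
  rintro r ⟨lam, hl0, hl1, hlam⟩ hsemi
  obtain ⟨K, hK0, hK⟩ := hsemi.exists_near_smul
  obtain ⟨N, hN⟩ := exists_nat_gt (32 * K / lam)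
  have hK1 : (1 : ℝ) ≤ K := Nat.one_le_cast.2 hK0
  -- `N` is so large that rounding errors are below `lam / 8` of it.
  have hKN : 32 * K < lam * N := by
    rw [div_lt_iff₀ hl0] at hN
    linarith
  have hN0 : (0 : ℝ) < N := lt_of_le_of_lt (by positivity) hN
  have hlN : lam * N ≤ N := mul_le_of_le_one_left hN0.le hl1
  have hKN' : 2 * K ≤ N := by
    have : (2 * K : ℝ) ≤ N := by linarith
    exact_mod_cast this
  refine ⟨N - 2 * K, N + 2 * K, lam / 4, lam / 8, by linarith, by linarith, by linarith,
    by linarith, fun D hD hDsize => ?_⟩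
  have hDd := hCdeg D hD
  have hDpos : 0 < D.size := by omega
  have hDpos' : (0 : ℝ) < D.size := Nat.cast_pos.2 hDpos
  have hND : (N : ℝ) ≤ D.size := by
    have : N ≤ D.size := by omega
    exact_mod_cast this
  constructor
  · intro hDP
    obtain ⟨_, ⟨E, hE, rfl⟩, hle⟩ := hK _ ⟨D, hDP, rfl⟩ (N / D.size) (by positivity)
    have hratio : (N : ℝ) / D.size ≤ 1 := (div_le_one hDpos').2 hND
    have hle' : ∑ τ, |(E.hist d r τ : ℝ) - N / D.size * D.hist d r τ| ≤ 2 * K :=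
      hle.trans (by nlinarith)
    obtain ⟨h1, h2⟩ := RelDB.dvDist_le_of_near hDd (hCdeg E (hPC hE)) hDpos hN0 hle'
    obtain ⟨h3, h4⟩ := abs_le.1 h1
    refine ⟨E, hE, ?_, ?_, h2.trans ?_⟩
    · have : (N : ℝ) ≤ (E.size + 2 * K : ℕ) := by push_cast; linarith
      have := Nat.cast_le.1 this
      omega
    · have : (E.size : ℝ) ≤ (N + 2 * K : ℕ) := by push_cast; linarith
      exact Nat.cast_le.1 this
    · rw [div_le_iff₀ hN0]
      linarith
  · intro hfar E hE hmin _
    by_contra! hclose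
    have hEsize : (N : ℝ) / 2 ≤ E.size := by
      have h1 : (N : ℝ) ≤ (E.size + 2 * K : ℕ) := Nat.cast_le.2 (by omega)
      push_cast at h1
      linarith
    have hEpos : (0 : ℝ) < E.size := by linarith
    have hED : (E.size : ℝ) ≤ D.size := Nat.cast_le.2 (by omega)
    obtain ⟨_, ⟨F, hF, rfl⟩, hle⟩ := hK _ ⟨E, hE, rfl⟩ (D.size / E.size) (by positivity)
    have hround : (K : ℝ) * (1 + D.size / E.size) ≤ lam / 8 * D.size := by
      have h1 : 1 + (D.size : ℝ) / E.size ≤ 4 * D.size / N := by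
        rw [← div_self hEpos.ne', ← add_div, div_le_div_iff₀ hEpos hN0]
        nlinarith
      refine (mul_le_mul_of_nonneg_left h1 (Nat.cast_nonneg K)).trans ?_
      rw [mul_div_assoc', div_le_iff₀ hN0]
      nlinarith
    have hFD := RelDB.histDist_le_of_near (D := D) (E := E) (F := F) hDpos (hle.trans hround)
    have hdv := mul_le_mul_of_nonneg_left hclose hDpos'.le
    have hFD' : RelDB.histDist d r F D ≤ lam / 2 * D.size := by linarith
    have hsize := abs_le.1 ((RelDB.abs_size_sub_le (hCdeg F (hPC hF)) hDd r).trans hFD')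
    have hlD : lam * D.size ≤ D.size := mul_le_of_le_one_left hDpos'.le hl1
    refine hfar (hlam F hF D hD (hFD'.trans ?_))
    have hmin' : (D.size : ℝ) / 2 ≤ min (F.size : ℝ) D.size :=
      le_min (by linarith [hsize.1]) (by linarith)
    have := mul_le_mul_of_nonneg_left hmin' hl0.le
    linarith
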